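/- Let $G$ be a connected (real, finite-dimensional) Lie group with Lie algebra $\mathfrak g$, $H\subset G$ a closed subgroup with Lie algebra $\mathfrak h$, let $p:G\to G/H$ be the projection and $\bar e=H\in G/H$. For a bivector field $\pi$ and a covector $\alpha$, let $\alpha^{\#}$ be the tangent vector with $\langle\beta,\alpha^{\#}\rangle=\pi(\alpha,\beta)$ for all covectors $\beta$ at the same point. A symplectic form on a vector space is a nondegenerate alternating bilinear form. (1) Let $(G,H)$ be a reductive pair with fixed decomposition $\mathfrak g=\mathfrak h\oplus\mathfrak m$, $\mathrm{Ad}(H)\mathfrak m=\mathfrak m$, and write $u_{\mathfrak m}$ for the $\mathfrak m$-component of $u\in\mathfrak g$. There is a one-to-one correspondence between $G$-invariant Poisson bivector fields $\pi$ on $G/H$ and pairs $(W,\omega)$, where $W\subset\mathfrak m$ is an $\mathrm{Ad}(H)$-invariant subspace and $\omega$ is an $\mathrm{Ad}(H)$-invariant symplectic form on $W$ such that for all $x,y,z\in W$ $$[x,y]_{\mathfrak m}\in W,\qquad \omega([x,y]_{\mathfrak m},z)+\omega([z,x]_{\mathfrak m},y)+\omega([y,z]_{\mathfrak m},x)=0.$$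 It sends $\pi$ to the pair for which, under the identification $T_ep:\mathfrak m\cong T_{\bar e}(G/H)$, $W=\{\alpha^{\#}:\alpha\in T^*_{\bar e}(G/H)\}$ and $\omega(\alpha^{\#},\beta^{\#})=\pi_{\bar e}(\alpha,\beta)$. (2) If moreover $[\mathfrak m,\mathfrak m]\subset\mathfrak h$ (symmetric pair), then the two conditions on $[\cdot,\cdot]_{\mathfrak m}$ hold automatically, so the $G$-invariant Poisson bivector fields on $G/H$ correspond one-to-one, in the same way, to all pairs $(W,\omega)$ of an $\mathrm{Ad}(H)$-invariant subspace $W\subset\mathfrak m$ and an $\mathrm{Ad}(H)$-invariant symplectic form $\omega$ on $W$. (3) If, in the situation of (1), the isotropy representation $\mathrm{Ad}:H\to\mathrm{GL}(\mathfrak m)$ is irreducible, then every $G$-invariant Poisson bivector field on $G/H$ is trivial or nondegenerate (i.e. symplectic). In particular, for every $n\ge 0$, the only $\mathrm{SO}(2n+2)$-invariant Poisson bivector field on the sphere $S^{2n+1}$ is the trivial one. (4) There is a one-to-one correspondence between bi-invariant Poisson structures $\pi$ on $G$ (i.e. invariant under $x\mapsto axb^{-1}$ for all $a,b\in G$) and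 pairs $(W,\omega)$, where $W$ is an abelian ideal of $\mathfrak g$ and $\omega$ is an $\mathrm{ad}(\mathfrak g)$-invariant symplectic form on $W$. It sends $\pi$ to $W=\{\alpha^{\#}:\alpha\in T_e^*G\}\subset\mathfrak g$ with $\omega(\alpha^{\#},\beta^{\#})=\pi_e(\alpha,\beta)$. -/

import Mathlib

open scoped Manifold ContDiff EuclideanSpace

noncomputable section

namespace InvariantPoisson

/-! ### Bivector fields and Poisson structures on a manifold -/

section Manifold

/-- A smooth skew-symmetric bivector field `π` on a manifold `M` modelled on the (finite-dimensional)
space `F`: at every point, an element of `⋀² T_x M`, viewed as an alternating bilinear form on the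
cotangent space. Smoothness means that `π(df, dg)` is smooth for all smooth functions `f`, `g`. -/
structure BivectorField (F : Type*) [NormedAddCommGroup F] [NormedSpace ℝ F]
    (M : Type*) [TopologicalSpace M] [ChartedSpace F M] where
  toFun : ∀ x : M, (TangentSpace 𝓘(ℝ, F) x →L[ℝ] ℝ) →ₗ[ℝ] (TangentSpace 𝓘(ℝ, F) x →L[ℝ] ℝ) →ₗ[ℝ] ℝ
  alternating : ∀ (x : M) (α : TangentSpace 𝓘(ℝ, F) x →L[ℝ] ℝ), toFun x α α = 0
  smooth : ∀ f g : M → ℝ, ContMDiff 𝓘(ℝ, F) 𝓘(ℝ, ℝ) ∞ f → ContMDiff 𝓘(ℝ, F) 𝓘(ℝ, ℝ) ∞ g →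
    ContMDiff 𝓘(ℝ, F) 𝓘(ℝ, ℝ) ∞
      fun x => toFun x (mvfderiv 𝓘(ℝ, F) f x) (mvfderiv 𝓘(ℝ, F) g x)

variable {F : Type*} [NormedAddCommGroup F] [NormedSpace ℝ F]
  {M : Type*} [TopologicalSpace M] [ChartedSpace F M]

namespace BivectorField

/-- The bracket of functions `{f, g} = π(df, dg)`. -/
def bracket (π : BivectorField F M) (f g : M → ℝ) (x : M) : ℝ :=
  π.toFun x (mvfderiv 𝓘(ℝ, F) f x) (mvfderiv 𝓘(ℝ, F) g x)

/-- `π` is a Poisson bivector field, `[π, π] = 0` for the Schouten bracket, that is, `{·, ·}`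
satisfies the Jacobi identity on smooth functions (`[π, π](df, dg, dh)` is, up to a nonzero
constant factor, the Jacobiator of `f`, `g`, `h`). -/
def IsPoisson (π : BivectorField F M) : Prop :=
  ∀ f g h : M → ℝ, ContMDiff 𝓘(ℝ, F) 𝓘(ℝ, ℝ) ∞ f → ContMDiff 𝓘(ℝ, F) 𝓘(ℝ, ℝ) ∞ g →
    ContMDiff 𝓘(ℝ, F) 𝓘(ℝ, ℝ) ∞ h → ∀ x : M,
      π.bracket f (π.bracket g h) x + π.bracket g (π.bracket h f) x
        + π.bracket h (π.bracket f g) x = 0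

/-- `π` is invariant under the diffeomorphism `φ`: `π(φ^* α, φ^* β) = π(α, β) ∘ φ`. -/
def InvariantUnder (π : BivectorField F M) (φ : M → M) : Prop :=
  ∀ (x : M) (α β : TangentSpace 𝓘(ℝ, F) (φ x) →L[ℝ] ℝ),
    π.toFun x (α.comp (mfderiv 𝓘(ℝ, F) 𝓘(ℝ, F) φ x)) (β.comp (mfderiv 𝓘(ℝ, F) 𝓘(ℝ, F) φ x))
      = π.toFun (φ x) α β

/-- `v = α^#` at the point `x`, i.e. `⟨β, v⟩ = π(α, β)` for all covectors `β`. -/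
def IsSharp (π : BivectorField F M) (x : M) (α : TangentSpace 𝓘(ℝ, F) x →L[ℝ] ℝ)
    (v : TangentSpace 𝓘(ℝ, F) x) : Prop :=
  ∀ β : TangentSpace 𝓘(ℝ, F) x →L[ℝ] ℝ, β v = π.toFun x α β

/-- The trivial bivector field. -/
def IsTrivial (π : BivectorField F M) : Prop := ∀ x : M, π.toFun x = 0

/-- Nondegeneracy at every point (for a Poisson bivector field: `π` is symplectic). -/
def Nondegenerate (π : BivectorField F M) : Prop :=
  ∀ (x : M) (α : TangentSpace 𝓘(ℝ, F) x →L[ℝ] ℝ), (∀ β, π.toFun x α β = 0) → α = 0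

end BivectorField

end Manifold

/-! ### Lie groups, closed subgroups, the adjoint action -/

section Group

variable {E : Type*} [NormedAddCommGroup E] [NormedSpace ℝ E]
  {G : Type*} [TopologicalSpace G] [ChartedSpace E G] [Group G]

/-- A smooth Lie group is smooth enough for its tangent space at `1` to be a Lie algebra. -/
instance instLieGroupMinSmoothness [LieGroup 𝓘(ℝ, E) ∞ G] :
    LieGroup 𝓘(ℝ, E) (minSmoothness ℝ 3) G := by
  rw [minSmoothness_of_isRCLikeNormedField]
  infer_instance

/-- The adjoint action `Ad_a`, the derivative at `1` of `x ↦ a x a⁻¹`. -/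
def Ad (a : G) : GroupLieAlgebra 𝓘(ℝ, E) G →L[ℝ] GroupLieAlgebra 𝓘(ℝ, E) G :=
  (mfderiv 𝓘(ℝ, E) 𝓘(ℝ, E) (fun x : G => a * x * a⁻¹) 1 : E →L[ℝ] E)

/-- `X` is the velocity at time `0` of a smooth curve of `G` which runs inside `H` and starts
at `1`. -/
def IsVelocityIn (H : Subgroup G) (X : GroupLieAlgebra 𝓘(ℝ, E) G) : Prop :=
  ∃ γ : ℝ → G, ContMDiff 𝓘(ℝ, ℝ) 𝓘(ℝ, E) ∞ γ ∧ (∀ t, γ t ∈ H) ∧ γ 0 = 1 ∧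
    (mfderiv 𝓘(ℝ, ℝ) 𝓘(ℝ, E) γ 0 : ℝ →L[ℝ] E) 1 = X

theorem IsVelocityIn.zero (H : Subgroup G) :
    IsVelocityIn H (0 : GroupLieAlgebra 𝓘(ℝ, E) G) := by
  refine ⟨fun _ => 1, contMDiff_const, fun _ => H.one_mem, rfl, ?_⟩
  rw [mfderiv_const]
  rfl

theorem IsVelocityIn.smul {H : Subgroup G} {X : GroupLieAlgebra 𝓘(ℝ, E) G}
    (hX : IsVelocityIn H X) (c : ℝ) : IsVelocityIn H (c • X) := by
  obtain ⟨γ, hγ, hH, h0, hv⟩ := hX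
  have hd : HasMFDerivAt 𝓘(ℝ, ℝ) 𝓘(ℝ, E) γ (c • (0 : ℝ)) (mfderiv 𝓘(ℝ, ℝ) 𝓘(ℝ, E) γ (c • (0 : ℝ))) :=
    ((hγ.mdifferentiable (by simp)) _).hasMFDerivAt
  have hs : HasMFDerivAt 𝓘(ℝ, ℝ) 𝓘(ℝ, ℝ) (fun t : ℝ => c • t) 0
      (c • ContinuousLinearMap.id ℝ ℝ) :=
    ((hasFDerivAt_id (𝕜 := ℝ) (0 : ℝ)).const_smul c).hasMFDerivAt
  refine ⟨γ ∘ fun t => c • t, hγ.comp ?_, fun t => hH _, by simp [h0], ?_⟩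
  · exact (contDiff_const_smul c).contMDiff
  · rw [(hd.comp (0 : ℝ) hs).mfderiv]
    have key : ∀ s : ℝ, s = 0 → (mfderiv 𝓘(ℝ, ℝ) 𝓘(ℝ, E) γ s : ℝ →L[ℝ] E) 1 = X := by
      rintro s rfl
      exact hv
    have h1 := key (c • (0 : ℝ)) (smul_zero c)
    change (mfderiv 𝓘(ℝ, ℝ) 𝓘(ℝ, E) γ (c • (0 : ℝ)) : ℝ →L[ℝ] E) (c • (1 : ℝ)) = c • X
    exact (ContinuousLinearMap.map_smul (mfderiv 𝓘(ℝ, ℝ) 𝓘(ℝ, E) γ (c • (0 : ℝ)) : ℝ →L[ℝ] E)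
      c 1).trans (congrArg (fun v : E => c • v) h1)

theorem IsVelocityIn.add [LieGroup 𝓘(ℝ, E) ∞ G] {H : Subgroup G}
    {X Y : GroupLieAlgebra 𝓘(ℝ, E) G}
    (hX : IsVelocityIn H X) (hY : IsVelocityIn H Y) : IsVelocityIn H (X + Y) := by
  obtain ⟨γ, hγ, hH, h0, hv⟩ := hX
  obtain ⟨δ, hδ, hH', h0', hv'⟩ := hY
  have hdγ := ((hγ.mdifferentiable (by simp)) 0).hasMFDerivAt
  have hdδ := ((hδ.mdifferentiable (by simp)) 0).hasMFDerivAt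
  have hm : MDifferentiableAt (𝓘(ℝ, E).prod 𝓘(ℝ, E)) 𝓘(ℝ, E) (fun p : G × G => p.1 * p.2)
      (γ 0, δ 0) :=
    ((contMDiff_mul 𝓘(ℝ, E) ∞).mdifferentiable (by simp)) _
  refine ⟨fun t => γ t * δ t, hγ.mul hδ, fun t => H.mul_mem (hH t) (hH' t), by simp [h0, h0'], ?_⟩
  have hcomp := HasMFDerivAt.comp (0 : ℝ) hm.hasMFDerivAt (hdγ.prodMk hdδ)
  have e : (fun t => γ t * δ t) = (fun p : G × G => p.1 * p.2) ∘ fun t => (γ t, δ t) := rfl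
  rw [e, hcomp.mfderiv]
  have hL : ∀ (g : G), g = 1 → ∀ h : G, h = 1 → ∀ u v : E,
      (mfderiv (𝓘(ℝ, E).prod 𝓘(ℝ, E)) 𝓘(ℝ, E) (fun p : G × G => p.1 * p.2) (g, h) :
        E × E →L[ℝ] E) (u, v) = u + v := by
    rintro g rfl h rfl u v
    have hm1 : MDifferentiableAt (𝓘(ℝ, E).prod 𝓘(ℝ, E)) 𝓘(ℝ, E) (fun p : G × G => p.1 * p.2)
        ((1 : G), (1 : G)) :=
      ((contMDiff_mul 𝓘(ℝ, E) ∞).mdifferentiable (by simp)) _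
    refine (mfderiv_prod_eq_add_apply (v := (u, v)) hm1).trans ?_
    have e1 : HasMFDerivAt 𝓘(ℝ, E) 𝓘(ℝ, E) (fun z : G => z * 1) 1
        (ContinuousLinearMap.id ℝ E : E →L[ℝ] E) := by
      rw [show (fun z : G => z * 1) = id by ext; simp]
      exact hasMFDerivAt_id 1
    have e2 : HasMFDerivAt 𝓘(ℝ, E) 𝓘(ℝ, E) (fun z : G => 1 * z) 1
        (ContinuousLinearMap.id ℝ E : E →L[ℝ] E) := by
      rw [show (fun z : G => 1 * z) = id by ext; simp]
      exact hasMFDerivAt_id 1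
    exact congrArg₂ (fun A B : E →L[ℝ] E => A u + B v) e1.mfderiv e2.mfderiv
  refine (hL (γ 0) h0 (δ 0) h0' _ _).trans ?_
  exact congrArg₂ (fun u v : E => u + v) hv hv'

/-- The Lie algebra `𝔥 ⊆ 𝔤` of a closed subgroup `H` of `G`: its tangent space at `1`. -/
def subgroupLieAlgebra [LieGroup 𝓘(ℝ, E) ∞ G] (H : Subgroup G) :
    Submodule ℝ (GroupLieAlgebra 𝓘(ℝ, E) G) where
  carrier := {X | IsVelocityIn H X}
  zero_mem' := IsVelocityIn.zero H
  add_mem' := IsVelocityIn.add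
  smul_mem' c _ hX := hX.smul c

/-- `W` is stable under `Ad_a` for all `a ∈ H`. -/
def IsAdInvariant (H : Subgroup G) (W : Submodule ℝ (GroupLieAlgebra 𝓘(ℝ, E) G)) : Prop :=
  ∀ a ∈ H, ∀ u ∈ W, Ad a u ∈ W

/-- The isotropy representation `Ad : H → GL(𝔪)` is irreducible. -/
def IsAdIrreducible (H : Subgroup G) (𝔪 : Submodule ℝ (GroupLieAlgebra 𝓘(ℝ, E) G)) : Prop :=
  𝔪 ≠ ⊥ ∧ ∀ W : Submodule ℝ (GroupLieAlgebra 𝓘(ℝ, E) G), W ≤ 𝔪 → IsAdInvariant H W →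
    W = ⊥ ∨ W = 𝔪

/-- Pairs `(W, ω)` of an `Ad(H)`-invariant subspace `W ⊆ 𝔪` and an `Ad(H)`-invariant symplectic
(i.e. alternating and nondegenerate bilinear) form `ω` on `W`. -/
structure SymplecticSubspace (H : Subgroup G)
    (𝔪 : Submodule ℝ (GroupLieAlgebra 𝓘(ℝ, E) G)) where
  W : Submodule ℝ (GroupLieAlgebra 𝓘(ℝ, E) G)
  le : W ≤ 𝔪
  adInvariant : IsAdInvariant H W
  form : LinearMap.BilinForm ℝ W
  alt : form.IsAlt
  nondegenerate : form.Nondegenerate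
  form_adInvariant : ∀ (a : G) (ha : a ∈ H) (u v : W),
    form ⟨Ad a u, adInvariant a ha u u.2⟩ ⟨Ad a v, adInvariant a ha v v.2⟩ = form u v

variable [LieGroup 𝓘(ℝ, E) ∞ G]

/-- The `𝔪`-component `[x, y]_𝔪` of the bracket, for `𝔤 = 𝔪 ⊕ 𝔥`. -/
def bracketOn {𝔪 𝔥 : Submodule ℝ (GroupLieAlgebra 𝓘(ℝ, E) G)} (h𝔪 : IsCompl 𝔪 𝔥)
    (x y : GroupLieAlgebra 𝓘(ℝ, E) G) : GroupLieAlgebra 𝓘(ℝ, E) G :=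
  (𝔪.projectionOnto 𝔥 h𝔪 ⁅x, y⁆ : 𝔪)

/-- `W` is closed under `[·, ·]_𝔪` and `ω` satisfies the cocycle identity for `[·, ·]_𝔪`. -/
def SymplecticSubspace.IsCocyclePair {H : Subgroup G}
    {𝔪 𝔥 : Submodule ℝ (GroupLieAlgebra 𝓘(ℝ, E) G)} (h𝔪 : IsCompl 𝔪 𝔥)
    (P : SymplecticSubspace H 𝔪) : Prop :=
  ∃ hW : ∀ x y : P.W, bracketOn h𝔪 (x : GroupLieAlgebra 𝓘(ℝ, E) G) y ∈ P.W,
    ∀ x y z : P.W,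
      P.form ⟨_, hW x y⟩ z + P.form ⟨_, hW z x⟩ y + P.form ⟨_, hW y z⟩ x = 0

/-- Pairs `(W, ω)` of an abelian ideal `W` of `𝔤` and an `ad(𝔤)`-invariant symplectic form `ω`
on `W`. -/
structure SymplecticAbelianIdeal (E : Type*) [NormedAddCommGroup E] [NormedSpace ℝ E]
    [CompleteSpace E] (G : Type*) [TopologicalSpace G] [ChartedSpace E G] [Group G]
    [LieGroup 𝓘(ℝ, E) ∞ G] where
  W : LieIdeal ℝ (GroupLieAlgebra 𝓘(ℝ, E) G)
  abelian : ∀ u v : W, ⁅(u : GroupLieAlgebra 𝓘(ℝ, E) G), (v : GroupLieAlgebra 𝓘(ℝ, E) G)⁆ = 0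
  form : LinearMap.BilinForm ℝ W
  alt : form.IsAlt
  nondegenerate : form.Nondegenerate
  form_adInvariant : ∀ (x : GroupLieAlgebra 𝓘(ℝ, E) G) (u v : W), form ⁅x, u⁆ v + form u ⁅x, v⁆ = 0

end Group

/-! ### Invariant bivector fields on `G ⧸ H` and on `G` -/

section Homogeneous

variable {E : Type*} [NormedAddCommGroup E] [NormedSpace ℝ E]
  {G : Type*} [TopologicalSpace G] [ChartedSpace E G] [Group G]

/-- The manifold structure on `G ⧸ H` (with the quotient topology) is the standard one of a
homogeneous space: the unique smooth structure for which the projection `p : G → G ⧸ H` is a smooth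
submersion. -/
class IsHomogeneousManifold (E : Type*) [NormedAddCommGroup E] [NormedSpace ℝ E]
    {G : Type*} [TopologicalSpace G] [ChartedSpace E G] [Group G] (H : Subgroup G)
    (F : Type*) [NormedAddCommGroup F] [NormedSpace ℝ F] [ChartedSpace F (G ⧸ H)] : Prop where
  isManifold : IsManifold 𝓘(ℝ, F) ∞ (G ⧸ H)
  isSubmersion : Manifold.IsSubmersion 𝓘(ℝ, E) 𝓘(ℝ, F) ∞ (QuotientGroup.mk : G → G ⧸ H)

variable {H : Subgroup G} {F : Type*} [NormedAddCommGroup F] [NormedSpace ℝ F]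
  [ChartedSpace F (G ⧸ H)]

/-- `π` is invariant under `λ_g : aH ↦ gaH` for all `g ∈ G`. -/
def IsGInvariant (π : BivectorField F (G ⧸ H)) : Prop :=
  ∀ g : G, π.InvariantUnder fun x => g • x

/-- The tangent map `T_e p : 𝔤 → T_ē (G ⧸ H)` of the projection. -/
def tangentProj (E : Type*) [NormedAddCommGroup E] [NormedSpace ℝ E]
    {G : Type*} [TopologicalSpace G] [ChartedSpace E G] [Group G] (H : Subgroup G)
    (F : Type*) [NormedAddCommGroup F] [NormedSpace ℝ F] [ChartedSpace F (G ⧸ H)] :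
    GroupLieAlgebra 𝓘(ℝ, E) G →L[ℝ] TangentSpace 𝓘(ℝ, F) ((1 : G) : G ⧸ H) :=
  mfderiv 𝓘(ℝ, E) 𝓘(ℝ, F) (QuotientGroup.mk : G → G ⧸ H) 1

/-- The pair `(W, ω)` is the one of `π`: when `T_ē (G ⧸ H)` is identified with `𝔪` through `T_e p`,
`W` is the image of `π_# : α ↦ α^#` at `ē`, and `ω(α^#, β^#) = π(α, β)`. -/
def IsPairOf {𝔪 : Submodule ℝ (GroupLieAlgebra 𝓘(ℝ, E) G)}
    (π : BivectorField F (G ⧸ H)) (P : SymplecticSubspace H 𝔪) : Prop :=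
  (∀ u, u ∈ P.W ↔ u ∈ 𝔪 ∧ ∃ α, π.IsSharp ((1 : G) : G ⧸ H) α (tangentProj E H F u)) ∧
  ∀ (u v : P.W) (α β : TangentSpace 𝓘(ℝ, F) ((1 : G) : G ⧸ H) →L[ℝ] ℝ),
    π.IsSharp ((1 : G) : G ⧸ H) α (tangentProj E H F u) →
    π.IsSharp ((1 : G) : G ⧸ H) β (tangentProj E H F v) →
    P.form u v = π.toFun ((1 : G) : G ⧸ H) α β

/-- `π` is a bi-invariant bivector field on `G`: invariant under the action
`(a, b) · x = a x b⁻¹` of `G × G`. -/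
def IsBiInvariant (π : BivectorField E G) : Prop :=
  ∀ a b : G, π.InvariantUnder fun x => a * x * b⁻¹

/-- `W` is the image of `π_# : α ↦ α^#` at `1`, and `ω(α^#, β^#) = π(α, β)`. -/
def IsIdealOf [CompleteSpace E] [LieGroup 𝓘(ℝ, E) ∞ G]
    (π : BivectorField E G) (P : SymplecticAbelianIdeal E G) : Prop :=
  (∀ u, u ∈ P.W ↔ ∃ α, π.IsSharp (1 : G) α u) ∧
  ∀ (u v : P.W) (α β : TangentSpace 𝓘(ℝ, E) (1 : G) →L[ℝ] ℝ),
    π.IsSharp (1 : G) α u → π.IsSharp (1 : G) β v → P.form u v = π.toFun (1 : G) α β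

end Homogeneous

/-- The self-map of the unit sphere of a Euclidean space induced by a linear isometry. -/
def sphereMap {n : ℕ} (A : EuclideanSpace ℝ (Fin n) ≃ₗᵢ[ℝ] EuclideanSpace ℝ (Fin n))
    (x : Metric.sphere (0 : EuclideanSpace ℝ (Fin n)) 1) :
    Metric.sphere (0 : EuclideanSpace ℝ (Fin n)) 1 :=
  ⟨A x, by simp⟩

end InvariantPoisson

end

open InvariantPoisson

noncomputable section
set_option linter.unusedSectionVars false
namespace InvariantPoisson

/-! ### Bivectors on a vector space and symplectic subspaces -/

section LinearAlgebra

variable {V F : Type*} [AddCommGroup V] [Module ℝ V] [TopologicalSpace V]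
  [AddCommGroup F] [Module ℝ F] [TopologicalSpace F]

/-! A bivector `B` on a vector space amounts to a symplectic subspace: `W` is the image of `α ↦
α^#`, and `ω(α^#, β^#) = B(α, β)`. Conversely `α^#` is the unique `u ∈ W` with `ω(w, u) = α(w)` for
all `w ∈ W`, so `(W, ω)` gives back `B` (`exists_isLinearPairOf`, `exists_dualForm_isLinearPairOf`).
An invariant bivector field on a homogeneous space is determined by its value at the base point, and
any value fixed by the isotropy representation extends (`exists_bivectorField`). Since `T_e p` has
kernel `𝔥` and intertwines `Ad` on `H` with the isotropy representation, the invariant fields on `G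
⧸ H` are the `Ad(H)`-invariant pairs in `𝔪`.

For the Poisson condition, functions are pulled back to `G`, where the bracket becomes that of a
left invariant bivector. In the left trivialization its coefficients are constant, so the Jacobiator
consists of second derivatives, which pair up into commutators of left invariant fields
(`leftBracket_jacobi`). What remains is `γ([α^#, β^#])` summed cyclically. For `γ` vanishing on `W`
one has `γ^# = 0`, and the sum says that `W` is closed under `[·,·]_𝔪`; for the other covectors it
is the cocycle identity (`cocycle_iff`). In a symmetric pair `[·,·]_𝔪` vanishes on `𝔪`, and in the
irreducible case `W` is `0` or `𝔪`.

On a group, bi-invariance is left invariance together with `Ad`-invariance at `1`. By connectedness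
the latter is infinitesimal (`form_adE_iff`), and the derivative of `Ad` is the bracket (`mD_adE`).
So `W` is an ideal with invariant form, and invariance together with the cocycle identity forces
`[W, W] = 0`.

On the sphere a direct argument is used: a rotation fixing `x` and `w` and reversing `v` gives `π(v,
w) = -π(v, w)`. -/

/-- A bilinear form on the continuous dual of `F`. -/
abbrev DualForm (F : Type*) [AddCommGroup F] [Module ℝ F] [TopologicalSpace F]
    [IsTopologicalAddGroup F] [ContinuousConstSMul ℝ F] : Type _ :=
  (F →L[ℝ] ℝ) →ₗ[ℝ] (F →L[ℝ] ℝ) →ₗ[ℝ] ℝ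

variable [IsTopologicalAddGroup F] [ContinuousConstSMul ℝ F]

/-- `u` lifts `α^#` along the linear map `τ`. -/
def IsSharpLift (B : DualForm F) (τ : V →L[ℝ] F) (α : F →L[ℝ] ℝ) (u : V) : Prop :=
  ∀ β : F →L[ℝ] ℝ, β (τ u) = B α β

/-- `(W, σ)` is the symplectic subspace defined by the bivector `B` on `F`, transported to the
subspace `𝔪` of `V` along `τ`. -/
def IsLinearPairOf (𝔪 : Submodule ℝ V) (τ : V →L[ℝ] F) (B : DualForm F) (W : Submodule ℝ V)
    (σ : LinearMap.BilinForm ℝ W) : Prop :=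
  (∀ u, u ∈ W ↔ u ∈ 𝔪 ∧ ∃ α, IsSharpLift B τ α u) ∧
  ∀ (u v : W) (α β : F →L[ℝ] ℝ), IsSharpLift B τ α u → IsSharpLift B τ β v → σ u v = B α β

/-- Nondegeneracy is required in both arguments; for alternating forms one side gives the other. -/
theorem _root_.LinearMap.BilinForm.IsAlt.nondegenerate_of_forall {M : Type*} [AddCommGroup M]
    [Module ℝ M] {σ : LinearMap.BilinForm ℝ M} (hσ : σ.IsAlt)
    (h : ∀ u, (∀ v, σ u v = 0) → u = 0) : σ.Nondegenerate :=
  ⟨h, fun u hu => h u fun v => by rw [← hσ.neg_eq, hu v, neg_zero]⟩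

theorem DualForm.skew {B : DualForm F} (hB : ∀ α, B α α = 0) (α β : F →L[ℝ] ℝ) :
    B α β = -B β α := by
  have h := hB (α + β)
  simp only [map_add, LinearMap.add_apply, hB] at h
  linarith

variable [T2Space F] [FiniteDimensional ℝ F] [ContinuousSMul ℝ F]

/-- The map `α ↦ α^#` of a bivector. -/
def DualForm.sharp (B : DualForm F) : (F →L[ℝ] ℝ) →ₗ[ℝ] F :=
  (Module.evalEquiv ℝ F).symm.toLinearMap ∘ₗ
    (LinearMap.lcomp ℝ ℝ
      (LinearMap.toContinuousLinearMap : (F →ₗ[ℝ] ℝ) ≃ₗ[ℝ] (F →L[ℝ] ℝ)).toLinearMap) ∘ₗ B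

theorem DualForm.apply_sharp (B : DualForm F) (α β : F →L[ℝ] ℝ) : β (B.sharp α) = B α β := by
  have h := Module.apply_evalEquiv_symm_apply (R := ℝ) (M := F) β.toLinearMap
    ((LinearMap.lcomp ℝ ℝ
      (LinearMap.toContinuousLinearMap : (F →ₗ[ℝ] ℝ) ≃ₗ[ℝ] (F →L[ℝ] ℝ)).toLinearMap) (B α))
  refine Eq.trans h ?_
  rfl

theorem ext_of_forall_dual {x y : F} (h : ∀ β : F →L[ℝ] ℝ, β x = β y) : x = y := by
  refine (Module.forall_dual_apply_eq_zero_iff ℝ (x - y)).1 (fun f => ?_) |> sub_eq_zero.1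
  have := h (LinearMap.toContinuousLinearMap f)
  simpa [sub_eq_zero] using this

theorem isSharpLift_iff {B : DualForm F} {τ : V →L[ℝ] F} {α : F →L[ℝ] ℝ} {u : V} :
    IsSharpLift B τ α u ↔ τ u = B.sharp α :=
  ⟨fun h => ext_of_forall_dual fun β => by rw [h β, B.apply_sharp],
    fun h β => by rw [h, B.apply_sharp]⟩

/-! ### The dictionary between bivectors and symplectic subspaces -/

section Pair

variable {𝔪 W : Submodule ℝ V} {τ : V →L[ℝ] F} {B B' : DualForm F} {σ : LinearMap.BilinForm ℝ W}

/-- The working form of the correspondence: `α^#` represents `α` on `W` through the second argument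
of `σ`. By nondegeneracy this characterizes `α^#`, so `σ` determines the bivector. -/
theorem IsLinearPairOf.form_apply (h : IsLinearPairOf 𝔪 τ B W σ) {α : F →L[ℝ] ℝ} (w : W) {u : W}
    (hu : IsSharpLift B τ α u) : σ w u = α (τ w) := by
  obtain ⟨-, β, hβ⟩ := (h.1 w).1 w.2
  rw [h.2 w u β α hβ hu, hβ α]

theorem IsLinearPairOf.exists_sharpLift (h : IsLinearPairOf 𝔪 τ B W σ)
    (hτ : ∀ v, ∃ u ∈ 𝔪, τ u = v) (α : F →L[ℝ] ℝ) : ∃ u : W, IsSharpLift B τ α u := by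
  obtain ⟨u, hu, e⟩ := hτ (B.sharp α)
  exact ⟨⟨u, (h.1 u).2 ⟨hu, α, isSharpLift_iff.2 e⟩⟩, isSharpLift_iff.2 e⟩

theorem IsLinearPairOf.isSharpLift_of_forall (h : IsLinearPairOf 𝔪 τ B W σ)
    (hσ : σ.Nondegenerate) (hτ : ∀ v, ∃ u ∈ 𝔪, τ u = v) {α : F →L[ℝ] ℝ} {u : W}
    (hu : ∀ w : W, σ w u = α (τ w)) : IsSharpLift B τ α u := by
  obtain ⟨v, hv⟩ := h.exists_sharpLift hτ α
  have : u = v := by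
    refine sub_eq_zero.1 (hσ.2 _ fun w => ?_)
    rw [map_sub, hu, h.form_apply w hv, sub_self]
  rwa [this]

theorem IsLinearPairOf.form_unique (h : IsLinearPairOf 𝔪 τ B W σ) (hσ : σ.Nondegenerate)
    (h' : IsLinearPairOf 𝔪 τ B' W σ) (hτ : ∀ v, ∃ u ∈ 𝔪, τ u = v) : B = B' := by
  ext α β
  obtain ⟨u, hu⟩ := h.exists_sharpLift hτ α
  have hu' := h'.isSharpLift_of_forall hσ hτ (u := u) fun w => h.form_apply w hu
  rw [← hu β, ← hu' β]

theorem IsLinearPairOf.pair_unique {W' : Submodule ℝ V} {σ' : LinearMap.BilinForm ℝ W'}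
    (h : IsLinearPairOf 𝔪 τ B W σ) (h' : IsLinearPairOf 𝔪 τ B W' σ') : W = W' ∧ HEq σ σ' := by
  have hW : W = W' := by
    ext u
    rw [h.1, h'.1]
  subst hW
  refine ⟨rfl, heq_of_eq ?_⟩
  ext u v
  obtain ⟨-, α, hα⟩ := (h.1 u).1 u.2
  obtain ⟨-, β, hβ⟩ := (h.1 v).1 v.2
  exact (h.2 u v α β hα hβ).trans (h'.2 u v α β hα hβ).symm

/-- Every bivector defines a symplectic subspace. -/
theorem exists_isLinearPairOf (hB : ∀ α, B α α = 0) (hτ : ∀ v, ∃ u ∈ 𝔪, τ u = v)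
    (hinj : ∀ u ∈ 𝔪, τ u = 0 → u = 0) :
    ∃ (W : Submodule ℝ V) (σ : LinearMap.BilinForm ℝ W), W ≤ 𝔪 ∧ σ.IsAlt ∧ σ.Nondegenerate ∧
      IsLinearPairOf 𝔪 τ B W σ := by
  set W : Submodule ℝ V := 𝔪 ⊓ (LinearMap.range B.sharp).comap τ.toLinearMap with hWdef
  -- `s` picks linearly a covector with a given sharp. The form does not depend on this choice,
  -- because `B α β` depends on `β` only through `β^#`.
  obtain ⟨s, hs⟩ := B.sharp.rangeRestrict.exists_rightInverse_of_surjective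
    (LinearMap.range_rangeRestrict _)
  have hs' : ∀ v : LinearMap.range B.sharp, B.sharp (s v) = v := fun v =>
    congrArg Subtype.val (LinearMap.congr_fun hs v)
  let r : W →ₗ[ℝ] LinearMap.range B.sharp :=
    (τ.toLinearMap ∘ₗ W.subtype).codRestrict _ fun w => w.2.2
  have hr : ∀ w : W, τ w = B.sharp (s (r w)) := fun w => (hs' (r w)).symm
  let σ : LinearMap.BilinForm ℝ W := B.compl₁₂ (s ∘ₗ r) (s ∘ₗ r)
  have hσ : ∀ u v : W, σ u v = B (s (r u)) (s (r v)) := fun u v => rfl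
  have hpair : IsLinearPairOf 𝔪 τ B W σ := by
    refine ⟨fun u => and_congr_right fun _ => exists_congr fun α => ?_, fun u v α β hu hv => ?_⟩
    · rw [isSharpLift_iff]
      exact eq_comm
    · have h1 : B α (s (r v)) = B α β := by
        rw [DualForm.skew hB α, ← B.apply_sharp (s (r v)), ← hr, hv α, ← DualForm.skew hB]
      rw [← h1, hσ, ← B.apply_sharp, ← hr, hu]
  refine ⟨W, σ, inf_le_left, fun u => hB _, ?_, hpair⟩
  refine LinearMap.BilinForm.IsAlt.nondegenerate_of_forall (fun u => hB _) fun u hu => ?_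
  refine Subtype.ext (hinj u u.2.1 ?_)
  obtain ⟨-, α, hα⟩ := (hpair.1 u).1 u.2
  refine ext_of_forall_dual fun β => ?_
  obtain ⟨v, hv⟩ := hpair.exists_sharpLift hτ β
  rw [hα β, ← hpair.2 u v α β hα hv, hu, map_zero]

variable [FiniteDimensional ℝ V]

/-- Every symplectic subspace is defined by a bivector. -/
theorem exists_dualForm_isLinearPairOf (hW : W ≤ 𝔪) (hσ : σ.IsAlt) (hσ' : σ.Nondegenerate)
    (hinj : ∀ u ∈ 𝔪, τ u = 0 → u = 0) :
    ∃ B : DualForm F, (∀ α, B α α = 0) ∧ IsLinearPairOf 𝔪 τ B W σ := by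
  have hinj' : ∀ u ∈ 𝔪, ∀ v ∈ 𝔪, τ u = τ v → u = v := fun u hu v hv e =>
    sub_eq_zero.1 (hinj _ (𝔪.sub_mem hu hv) (by rw [map_sub, e, sub_self]))
  -- `c α` is the future `α^#`. The sign appears because `toDual` represents functionals through the
  -- first argument of `σ`, whereas the second one is needed.
  let c : (F →L[ℝ] ℝ) →ₗ[ℝ] W := -((σ.toDual hσ').symm.toLinearMap ∘ₗ
    { toFun := fun α => α.toLinearMap ∘ₗ τ.toLinearMap ∘ₗ W.subtype
      map_add' := fun _ _ => rfl
      map_smul' := fun _ _ => rfl })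
  have hc : ∀ α w, σ w (c α) = α (τ w) := fun α w => by
    rw [← hσ.neg_eq, ← LinearMap.map_neg₂]
    simp only [c, LinearMap.neg_apply, neg_neg]
    exact LinearMap.BilinForm.apply_toDual_symm_apply (B := σ) (hB := hσ') _ _
  let B : DualForm F := LinearMap.mk₂ ℝ (fun α β => β (τ (c α)))
    (fun _ _ _ => by simp) (fun _ _ _ => by simp) (fun _ _ _ => by simp) (fun _ _ _ => by simp)
  have hB : ∀ α β, B α β = β (τ (c α)) := fun _ _ => rfl
  refine ⟨B, fun α => by rw [hB, ← hc, hσ], fun u => ⟨fun hu => ⟨hW hu, ?_⟩, ?_⟩, ?_⟩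
  -- To see that `u ∈ W` is a sharp, extend `σ(·, u)` from `W` to `V` and carry it to `F` by a left
  -- inverse of `τ` on `𝔪`.
  · obtain ⟨ρ, hρ⟩ := (τ.toLinearMap ∘ₗ 𝔪.subtype).exists_leftInverse_of_injective
      (LinearMap.ker_eq_bot'.2 fun w hw => Subtype.ext (hinj w w.2 hw))
    obtain ⟨g, hg⟩ := (σ.flip ⟨u, hu⟩).exists_extend
    let α : F →L[ℝ] ℝ := LinearMap.toContinuousLinearMap (g ∘ₗ 𝔪.subtype ∘ₗ ρ)
    have hα : ∀ w : W, α (τ w) = σ w ⟨u, hu⟩ := fun w => by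
      have h1 : ρ (τ w) = ⟨w, hW w.2⟩ := LinearMap.congr_fun hρ ⟨w, hW w.2⟩
      have h2 : g w = σ w ⟨u, hu⟩ := LinearMap.congr_fun hg w
      change g (ρ (τ w) : V) = _
      rw [h1, ← h2]
    refine ⟨α, fun β => ?_⟩
    have : c α = ⟨u, hu⟩ := sub_eq_zero.1 (hσ'.2 _ fun w => by rw [map_sub, hc, hα, sub_self])
    rw [hB, this]
  · rintro ⟨hu, α, hα⟩
    rw [hinj' u hu (c α) (hW (c α).2) (ext_of_forall_dual hα)]
    exact (c α).2
  · intro u v α β hα hβ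
    have h1 : u = c α :=
      Subtype.ext (hinj' u (hW u.2) _ (hW (c α).2) (ext_of_forall_dual hα))
    have h2 : v = c β :=
      Subtype.ext (hinj' v (hW v.2) _ (hW (c β).2) (ext_of_forall_dual hβ))
    rw [h2, hc, h1, hB]

end Pair

/-! ### Invariance and the Jacobi identity, read on the symplectic subspace -/

section Invariance

variable {𝔪 W : Submodule ℝ V} {τ : V →L[ℝ] F} {B : DualForm F} {σ : LinearMap.BilinForm ℝ W}

/-- Naturality of the sharp map. In the applications `A` is `Ad_a`, `A'` is the isotropy action of
`a`, and `A''` below is a left inverse of `A'`. -/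
theorem IsSharpLift.map_of_invariant {A : V → V} {A' : F →L[ℝ] F}
    (hA : ∀ u, τ (A u) = A' (τ u))
    (hB : ∀ α β : F →L[ℝ] ℝ, B (α.comp A') (β.comp A') = B α β) {α : F →L[ℝ] ℝ} {u : V}
    (hu : IsSharpLift B τ (α.comp A') u) : IsSharpLift B τ α (A u) := fun β => by
  rw [hA, ← hB, ← hu]
  rfl

theorem IsLinearPairOf.mem_of_invariant (h : IsLinearPairOf 𝔪 τ B W σ) {A : V → V}
    {A' A'' : F →L[ℝ] F} (hA : ∀ u, τ (A u) = A' (τ u)) (hA'' : ∀ v, A'' (A' v) = v)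
    (hB : ∀ α β : F →L[ℝ] ℝ, B (α.comp A') (β.comp A') = B α β)
    (h𝔪 : ∀ u ∈ 𝔪, A u ∈ 𝔪) {u : V} (hu : u ∈ W) : A u ∈ W := by
  obtain ⟨hu, α, hα⟩ := (h.1 u).1 hu
  refine (h.1 _).2 ⟨h𝔪 u hu, α.comp A'', IsSharpLift.map_of_invariant hA hB ?_⟩
  convert hα using 1
  ext v
  exact congrArg α (hA'' v)

theorem IsLinearPairOf.form_of_invariant (h : IsLinearPairOf 𝔪 τ B W σ) {A : V → V}
    {A' A'' : F →L[ℝ] F} (hA : ∀ u, τ (A u) = A' (τ u)) (hA'' : ∀ v, A'' (A' v) = v)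
    (hB : ∀ α β : F →L[ℝ] ℝ, B (α.comp A') (β.comp A') = B α β) (u v : W)
    (hu : A u ∈ W) (hv : A v ∈ W) : σ ⟨A u, hu⟩ ⟨A v, hv⟩ = σ u v := by
  have key : ∀ α : F →L[ℝ] ℝ, (α.comp A'').comp A' = α := fun α => by
    ext w
    exact congrArg α (hA'' w)
  obtain ⟨-, α, hα⟩ := (h.1 u).1 u.2
  obtain ⟨-, β, hβ⟩ := (h.1 v).1 v.2
  rw [h.2 u v α β hα hβ, ← key α, ← key β, hB]
  rw [← key α] at hα
  rw [← key β] at hβ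
  exact h.2 _ _ _ _ (IsSharpLift.map_of_invariant hA hB hα) (IsSharpLift.map_of_invariant hA hB hβ)

/-- Since `A₁` also preserves `W`, `A` maps `W` onto itself. Hence `A` sends the vector of `W`
representing `α ∘ A'` to the one representing `α`. -/
theorem IsLinearPairOf.invariant_of_form (h : IsLinearPairOf 𝔪 τ B W σ) (hσ : σ.Nondegenerate)
    (hτ : ∀ v, ∃ u ∈ 𝔪, τ u = v) {A A₁ : V → V} {A' : F →L[ℝ] F}
    (hA : ∀ u, τ (A u) = A' (τ u)) (hAW : ∀ u ∈ W, A u ∈ W) (hA₁W : ∀ u ∈ W, A₁ u ∈ W)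
    (hA₁ : ∀ u, A (A₁ u) = u)
    (hform : ∀ u v : W, σ ⟨A u, hAW u u.2⟩ ⟨A v, hAW v v.2⟩ = σ u v) (α β : F →L[ℝ] ℝ) :
    B (α.comp A') (β.comp A') = B α β := by
  obtain ⟨u, hu⟩ := h.exists_sharpLift hτ (α.comp A')
  have hAu : IsSharpLift B τ α ((⟨A u, hAW u u.2⟩ : W) : V) := by
    refine h.isSharpLift_of_forall hσ hτ fun w => ?_
    have hw : w = ⟨A (A₁ w), hAW _ (hA₁W w w.2)⟩ := Subtype.ext (hA₁ w).symm
    have h1 := hform ⟨A₁ w, hA₁W w w.2⟩ u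
    rw [← hw, h.form_apply _ hu] at h1
    rw [h1]
    change α (A' (τ (A₁ w))) = _
    rw [← hA, hA₁]
  rw [← hu, ← hAu]
  exact congrArg β (hA u).symm

/-- The bivector of a symplectic subspace is annihilated by a derivation which preserves the
subspace and its form. -/
theorem IsLinearPairOf.derivation_of_form {W : Submodule ℝ F} {σ : LinearMap.BilinForm ℝ W}
    (h : IsLinearPairOf ⊤ (ContinuousLinearMap.id ℝ F) B W σ)
    (hσ : σ.Nondegenerate) (T : F →L[ℝ] F) (hT : ∀ u ∈ W, T u ∈ W)
    (hform : ∀ u v : W, σ ⟨T u, hT u u.2⟩ v + σ u ⟨T v, hT v v.2⟩ = 0) (α β : F →L[ℝ] ℝ) :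
    B (α.comp T) β + B α (β.comp T) = 0 := by
  have hτ : ∀ v, ∃ u ∈ (⊤ : Submodule ℝ F), ContinuousLinearMap.id ℝ F u = v :=
    fun v => ⟨v, trivial, rfl⟩
  obtain ⟨u, hu⟩ := h.exists_sharpLift hτ α
  have hTu : IsSharpLift B (ContinuousLinearMap.id ℝ F) (α.comp T)
      ((-⟨T u, hT u u.2⟩ : W) : F) := by
    refine h.isSharpLift_of_forall hσ hτ fun w => ?_
    rw [map_neg, neg_eq_of_add_eq_zero_left (hform w u), h.form_apply _ hu]
    rfl
  rw [← hTu, ← hu]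
  change β (-(T u)) + β (T u) = 0
  rw [map_neg, neg_add_cancel]

/-- Infinitesimal naturality; the sign comes from moving `T` from one argument of `B` to the other.
-/
theorem IsSharpLift.derivation {T : F →L[ℝ] F}
    (hB : ∀ α β : F →L[ℝ] ℝ, B (α.comp T) β + B α (β.comp T) = 0) {α : F →L[ℝ] ℝ} {u : F}
    (hu : IsSharpLift B (ContinuousLinearMap.id ℝ F) α u) :
    IsSharpLift B (ContinuousLinearMap.id ℝ F) (-(α.comp T)) (T u) := fun β => by
  have h := hu (β.comp T)
  rw [map_neg, LinearMap.neg_apply, ← eq_neg_of_add_eq_zero_right (hB α β), ← h]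
  rfl

/-- The pointwise form of the vanishing of the Jacobiator, in terms of the bivector and in terms of
the symplectic subspace. -/
theorem IsLinearPairOf.cocycle_iff (h : IsLinearPairOf 𝔪 τ B W σ) (hσ : σ.Nondegenerate)
    (hW : W ≤ 𝔪) (hτ : ∀ v, ∃ u ∈ 𝔪, τ u = v) (hinj : ∀ u ∈ 𝔪, τ u = 0 → u = 0)
    {br : V → V → V} (hbr : ∀ x y, br x y ∈ 𝔪) (hbr0 : ∀ x, br x 0 = 0) (hbr0' : ∀ x, br 0 x = 0) :
    (∀ (α β γ : F →L[ℝ] ℝ) (u v w : V), u ∈ 𝔪 → v ∈ 𝔪 → w ∈ 𝔪 → IsSharpLift B τ α u →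
      IsSharpLift B τ β v → IsSharpLift B τ γ w →
        γ (τ (br u v)) + α (τ (br v w)) + β (τ (br w u)) = 0) ↔
    ∃ hb : ∀ x y : W, br x y ∈ W, ∀ x y z : W,
      σ ⟨_, hb x y⟩ z + σ ⟨_, hb z x⟩ y + σ ⟨_, hb y z⟩ x = 0 := by
  constructor
  · intro hJ
    have hb : ∀ x y : W, br x y ∈ W := by
      intro x y
      -- A covector `γ` vanishing on `W` but not on `br x y` has `γ^# = 0`, so only the term `γ (τ
      -- (br x y))` of the cyclic sum survives.
      by_contra hxy
      obtain ⟨f, hf, hfW⟩ := Submodule.exists_le_ker_of_notMem hxy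
      obtain ⟨ρ, hρ⟩ := (τ.toLinearMap ∘ₗ 𝔪.subtype).exists_leftInverse_of_injective
        (LinearMap.ker_eq_bot'.2 fun w hw => Subtype.ext (hinj w w.2 hw))
      have hρ' : ∀ u (hu : u ∈ 𝔪), ρ (τ u) = ⟨u, hu⟩ := fun u hu => LinearMap.congr_fun hρ ⟨u, hu⟩
      let γ : F →L[ℝ] ℝ := LinearMap.toContinuousLinearMap (f ∘ₗ 𝔪.subtype ∘ₗ ρ)
      have hγ : ∀ u ∈ 𝔪, γ (τ u) = f u := fun u hu => by
        change f (ρ (τ u) : V) = f u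
        rw [hρ' u hu]
      have h0 : IsSharpLift B τ γ ((0 : W) : V) := by
        refine h.isSharpLift_of_forall hσ hτ fun w => ?_
        rw [map_zero, hγ w (hW w.2)]
        exact (hfW w.2).symm
      obtain ⟨-, α, hα⟩ := (h.1 x).1 x.2
      obtain ⟨-, β, hβ⟩ := (h.1 y).1 y.2
      have := hJ α β γ x y 0 (hW x.2) (hW y.2) 𝔪.zero_mem hα hβ h0
      rw [hbr0, hbr0', map_zero, map_zero, map_zero, add_zero, add_zero, hγ _ (hbr x y)] at this
      exact hf this
    refine ⟨hb, fun x y z => ?_⟩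
    obtain ⟨-, α, hα⟩ := (h.1 x).1 x.2
    obtain ⟨-, β, hβ⟩ := (h.1 y).1 y.2
    obtain ⟨-, γ, hγ⟩ := (h.1 z).1 z.2
    have := hJ α β γ x y z (hW x.2) (hW y.2) (hW z.2) hα hβ hγ
    rw [h.form_apply _ hα, h.form_apply _ hβ, h.form_apply _ hγ]
    linarith
  · rintro ⟨hb, hc⟩ α β γ u v w hu hv hw hα hβ hγ
    have hu' := (h.1 u).2 ⟨hu, α, hα⟩
    have hv' := (h.1 v).2 ⟨hv, β, hβ⟩
    have hw' := (h.1 w).2 ⟨hw, γ, hγ⟩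
    have := hc ⟨u, hu'⟩ ⟨v, hv'⟩ ⟨w, hw'⟩
    rw [h.form_apply _ (u := ⟨u, hu'⟩) hα, h.form_apply _ (u := ⟨v, hv'⟩) hβ,
      h.form_apply _ (u := ⟨w, hw'⟩) hγ] at this
    linarith

end Invariance

end LinearAlgebra

/-! ### Derivatives between boundaryless manifolds -/

section Derivative

variable (E F K : Type*) [NormedAddCommGroup E] [NormedSpace ℝ E]
  [NormedAddCommGroup F] [NormedSpace ℝ F] [NormedAddCommGroup K] [NormedSpace ℝ K]
  {M N P : Type*} [TopologicalSpace M] [ChartedSpace E M] [TopologicalSpace N] [ChartedSpace F N]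
  [TopologicalSpace P] [ChartedSpace K P]

/-- The manifold derivative, as a map between the model spaces. -/
def mD (f : M → N) (x : M) : E →L[ℝ] F := mfderiv 𝓘(ℝ, E) 𝓘(ℝ, F) f x

/-- The intermediate point `y` is a separate variable, so that base points such as `g * 1` and `g`
need not agree definitionally. -/
theorem mD_comp {g : N → P} {f : M → N} {x : M} {y : N} (hy : f x = y)
    (hg : MDifferentiableAt 𝓘(ℝ, F) 𝓘(ℝ, K) g y) (hf : MDifferentiableAt 𝓘(ℝ, E) 𝓘(ℝ, F) f x) :
    mD E K (fun z => g (f z)) x = (mD F K g y).comp (mD E F f x) := by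
  subst hy
  exact mfderiv_comp x hg hf

theorem mD_id (x : M) : mD E E (fun z : M => z) x = ContinuousLinearMap.id ℝ E :=
  mfderiv_id

theorem mD_const (x : M) (c : N) : mD E F (fun _ : M => c) x = 0 :=
  mfderiv_const

theorem mD_congr {f g : M → N} {x : M} (h : f =ᶠ[nhds x] g) : mD E F f x = mD E F g x :=
  h.mfderiv_eq

theorem mD_eq_fderiv (f : E → F) (x : E) : mD E F f x = fderiv ℝ f x :=
  mfderiv_eq_fderiv

variable {E F K}

theorem _root_.HasFDerivAt.mD_eq {f : E → F} {f' : E →L[ℝ] F} {x : E} (h : HasFDerivAt f f' x) :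
    mD E F f x = f' := by
  rw [mD_eq_fderiv, h.fderiv]

theorem _root_.ContMDiff.mdiffAt {f : M → N} (hf : ContMDiff 𝓘(ℝ, E) 𝓘(ℝ, F) ∞ f) (x : M) :
    MDifferentiableAt 𝓘(ℝ, E) 𝓘(ℝ, F) f x :=
  hf.mdifferentiable (by simp) x

/-- The derivative at a fixed point depends smoothly on parameters. -/
theorem contMDiff_mD_param [IsManifold 𝓘(ℝ, F) ∞ N] [IsManifold 𝓘(ℝ, E) ∞ M]
    [IsManifold 𝓘(ℝ, K) ∞ P] {f : N → M → P}
    (hf : ContMDiff (𝓘(ℝ, F).prod 𝓘(ℝ, E)) 𝓘(ℝ, K) ∞ (fun p : N × M => f p.1 p.2)) {x : M} {y : P}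
    (hy : ∀ n, f n x = y) :
    ContMDiff 𝓘(ℝ, F) 𝓘(ℝ, E →L[ℝ] K) ∞ (fun n => mD E K (f n) x) := by
  have : IsManifold 𝓘(ℝ, E) 1 M := .of_le (n := ∞) (by norm_cast)
  have : IsManifold 𝓘(ℝ, F) 1 N := .of_le (n := ∞) (by norm_cast)
  have : IsManifold 𝓘(ℝ, K) 1 P := .of_le (n := ∞) (by norm_cast)
  intro n₀
  have h : ContMDiffAt 𝓘(ℝ, F) 𝓘(ℝ, E →L[ℝ] K) ∞ (inTangentCoordinates 𝓘(ℝ, E) 𝓘(ℝ, K)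
      (fun _ => x) (fun n => f n x) (fun n => mD E K (f n) x) n₀) n₀ :=
    ContMDiffAt.mfderiv (I := 𝓘(ℝ, E)) (I' := 𝓘(ℝ, K)) (J := 𝓘(ℝ, F)) (x₀ := n₀)
      (m := ∞) (n := ∞) f (fun _ => x) (hf _) contMDiffAt_const (by simp)
  rw [show (fun n => f n x) = fun _ => y from funext hy] at h
  -- Source and target points are both constant in `n`, so the tangent coordinate changes are
  -- identities.
  refine h.congr_of_eventuallyEq (Filter.Eventually.of_forall fun n => ?_)
  refine Eq.trans ?_ (inTangentCoordinates_eq (I := 𝓘(ℝ, E)) (I' := 𝓘(ℝ, K)) (fun _ : N => x)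
    (fun _ => y) (fun n => mD E K (f n) x) (mem_chart_source _ _) (mem_chart_source _ _)).symm
  ext v
  symm
  refine ((tangentBundleCore 𝓘(ℝ, K) P).coordChange_self _ _ (mem_chart_source _ _) _).trans ?_
  exact congrArg (mD E K (f n) x)
    ((tangentBundleCore 𝓘(ℝ, E) M).coordChange_self _ _ (mem_chart_source _ _) v)

/-- The derivative at a fixed point of vector-valued functions depends smoothly on parameters. -/
theorem contMDiff_mD_param_vector [IsManifold 𝓘(ℝ, F) ∞ N] [IsManifold 𝓘(ℝ, E) ∞ M] {f : N → M → K}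
    (hf : ContMDiff (𝓘(ℝ, F).prod 𝓘(ℝ, E)) 𝓘(ℝ, K) ∞ (fun p : N × M => f p.1 p.2)) (x : M) :
    ContMDiff 𝓘(ℝ, F) 𝓘(ℝ, E →L[ℝ] K) ∞ (fun n => mD E K (f n) x) := by
  have h0 : ContMDiff 𝓘(ℝ, F) 𝓘(ℝ, K) ∞ (fun n => f n x) :=
    hf.comp (contMDiff_id.prodMk contMDiff_const)
  -- Subtracting the value at `x` fixes the target point at `0` without changing the derivative.
  have h1 : ContMDiff (𝓘(ℝ, F).prod 𝓘(ℝ, E)) 𝓘(ℝ, K) ∞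
      (fun p : N × M => f p.1 p.2 - f p.1 x) := hf.sub (h0.comp contMDiff_fst)
  have h2 := contMDiff_mD_param (f := fun n z => f n z - f n x) h1 (x := x) (y := 0)
    fun n => sub_self _
  convert h2 using 2 with n
  have hfn : MDifferentiableAt 𝓘(ℝ, E) 𝓘(ℝ, K) (f n) x :=
    (hf.comp (contMDiff_const.prodMk contMDiff_id)).mdiffAt x
  refine ((hfn.hasMFDerivAt.sub (hasMFDerivAt_const (f n x) x)).mfderiv.trans ?_).symm
  exact sub_zero (mD E K (f n) x)

theorem _root_.ContMDiff.exists_contDiffOn_chart [IsManifold 𝓘(ℝ, E) ∞ M] {f : M → F}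
    (hf : ContMDiff 𝓘(ℝ, E) 𝓘(ℝ, F) ∞ f) (x : M) :
    ContDiffOn ℝ ∞ (fun y => f ((extChartAt 𝓘(ℝ, E) x).symm y)) (extChartAt 𝓘(ℝ, E) x).target := by
  rw [← contMDiffOn_iff_contDiffOn]
  exact hf.comp_contMDiffOn (contMDiffOn_extChartAt_symm x)

/-- A function with vanishing derivative on a connected manifold is constant. -/
theorem eq_of_mD_eq_zero [PreconnectedSpace M] [IsManifold 𝓘(ℝ, E) ∞ M] {f : M → F}
    (hf : ContMDiff 𝓘(ℝ, E) 𝓘(ℝ, F) ∞ f) (h : ∀ x, mD E F f x = 0) (x y : M) : f x = f y := by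
  refine IsLocallyConstant.apply_eq_of_isPreconnected (s := Set.univ) ?_ isPreconnected_univ
    trivial trivial
  rw [IsLocallyConstant.iff_eventually_eq]
  intro x
  set φ := extChartAt 𝓘(ℝ, E) x
  have ht : φ.target ∈ nhds (φ x) := extChartAt_target_mem_nhds x
  obtain ⟨r, hr, hball⟩ := Metric.mem_nhds_iff.1 ht
  have hopen : IsOpen φ.target := isOpen_extChartAt_target x
  have hsm := hf.exists_contDiffOn_chart x
  -- Constancy is only needed locally, so a convex ball inside a chart suffices.
  have hd : ∀ y ∈ Metric.ball (φ x) r, HasFDerivAt (fun y => f (φ.symm y)) (0 : E →L[ℝ] F) y := by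
    intro y hy
    have hy' := hball hy
    have h1 : DifferentiableAt ℝ (fun y => f (φ.symm y)) y :=
      (hsm.contDiffAt (hopen.mem_nhds hy')).differentiableAt (by simp)
    have h2 : MDifferentiableAt 𝓘(ℝ, E) 𝓘(ℝ, E) φ.symm y :=
      ((contMDiffOn_extChartAt_symm (n := ∞) x).contMDiffAt
        (hopen.mem_nhds hy')).mdifferentiableAt (by simp)
    have h3 := mD_comp E E F rfl (hf.mdiffAt _) h2
    rw [h, mD_eq_fderiv, ContinuousLinearMap.zero_comp] at h3
    rw [← h3]
    exact h1.hasFDerivAt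
  have hnhds : φ.source ∩ φ ⁻¹' Metric.ball (φ x) r ∈ nhds x :=
    Filter.inter_mem (extChartAt_source_mem_nhds x)
      ((continuousAt_extChartAt x).preimage_mem_nhds (Metric.ball_mem_nhds _ hr))
  filter_upwards [hnhds] with z hz
  have := (convex_ball (φ x) r).is_const_of_fderivWithin_eq_zero (𝕜 := ℝ)
    (f := fun y => f (φ.symm y))
    (fun y hy => (hd y hy).differentiableAt.differentiableWithinAt)
    (fun y hy => (hd y hy).hasFDerivWithinAt.fderivWithin
      (Metric.isOpen_ball.uniqueDiffWithinAt hy)) hz.2 (Metric.mem_ball_self hr)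
  rwa [φ.left_inv hz.1, extChartAt_to_inv] at this

end Derivative

/-! ### Functions with given differential and curves with given velocity -/

section Existence

variable {E F : Type*} [NormedAddCommGroup E] [NormedSpace ℝ E]
  [NormedAddCommGroup F] [NormedSpace ℝ F]
  {M : Type*} [TopologicalSpace M] [ChartedSpace E M]

theorem mdifferentiableAt_extChartAt_symm' [IsManifold 𝓘(ℝ, E) ∞ M] (x : M) {y : E}
    (hy : y ∈ (extChartAt 𝓘(ℝ, E) x).target) :
    MDifferentiableAt 𝓘(ℝ, E) 𝓘(ℝ, E) (extChartAt 𝓘(ℝ, E) x).symm y :=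
  ((contMDiffOn_extChartAt_symm (n := ∞) x).contMDiffAt
    ((isOpen_extChartAt_target x).mem_nhds hy)).mdifferentiableAt (by simp)

theorem mD_extChartAt_symm_self [IsManifold 𝓘(ℝ, E) 1 M] (x : M) :
    mD E E (extChartAt 𝓘(ℝ, E) x).symm (extChartAt 𝓘(ℝ, E) x x) = ContinuousLinearMap.id ℝ E := by
  have h := mfderivWithin_range_extChartAt_symm (I := 𝓘(ℝ, E)) (x := x)
  rw [modelWithCornersSelf_coe, Set.range_id, mfderivWithin_univ] at h
  exact h

/-- Every covector is the differential of a smooth function. -/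
theorem exists_contMDiff_mD_eq [FiniteDimensional ℝ E] [T2Space M] [IsManifold 𝓘(ℝ, E) ∞ M]
    (x : M) (α : E →L[ℝ] ℝ) :
    ∃ f : M → ℝ, ContMDiff 𝓘(ℝ, E) 𝓘(ℝ, ℝ) ∞ f ∧ mD E ℝ f x = α := by
  have : IsManifold 𝓘(ℝ, E) 1 M := .of_le (n := ∞) (by norm_cast)
  let ρ : SmoothBumpFunction 𝓘(ℝ, E) x := Classical.choice inferInstance
  have hg : ContMDiffOn 𝓘(ℝ, E) 𝓘(ℝ, ℝ) ∞ (fun z => α (extChartAt 𝓘(ℝ, E) x z))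
      (chartAt E x).source :=
    α.contMDiff.comp_contMDiffOn (contMDiffOn_extChartAt (x := x))
  refine ⟨fun z => ρ z • α (extChartAt 𝓘(ℝ, E) x z), ρ.contMDiff_smul hg, ?_⟩
  have h1 : (fun z => ρ z • α (extChartAt 𝓘(ℝ, E) x z)) =ᶠ[nhds x]
      fun z => α (extChartAt 𝓘(ℝ, E) x z) := by
    filter_upwards [ρ.eventuallyEq_one] with z hz
    rw [hz, Pi.one_apply, one_smul]
  have hα : MDifferentiableAt 𝓘(ℝ, E) 𝓘(ℝ, ℝ) α (extChartAt 𝓘(ℝ, E) x x) :=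
    α.mdifferentiableAt
  rw [mD_congr _ _ h1, mD_comp E E ℝ rfl hα
    (mdifferentiableAt_extChartAt (mem_chart_source E x)), mD_eq_fderiv, α.fderiv]
  have h2 : mD E E (extChartAt 𝓘(ℝ, E) x) x = ContinuousLinearMap.id ℝ E := mfderiv_extChartAt_self
  rw [h2, ContinuousLinearMap.comp_id]

/-- A vector whose flow line `c + t • v` stays in an open set for small times is the velocity of a
smooth curve which stays in that set for all times. -/
theorem exists_contDiff_curve {U : Set E} (hU : IsOpen U) {c : E} (hc : c ∈ U) (v : E) :
    ∃ s : ℝ → ℝ, ContDiff ℝ ∞ s ∧ s 0 = 0 ∧ HasDerivAt s 1 0 ∧ ∀ t, c + s t • v ∈ U := by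
  obtain ⟨r, hr, hball⟩ := Metric.mem_nhds_iff.1 (hU.mem_nhds hc)
  set ε : ℝ := r / (2 * (‖v‖ + 1)) with hε
  have hv : 0 < ‖v‖ + 1 := by positivity
  have hε0 : 0 < ε := by positivity
  -- The sine has slope `1` at `0` and keeps the displacement below `ε * ‖v‖ < r` for all times; the
  -- `+ 1` in `ε` covers `v = 0`.
  refine ⟨fun t => ε * Real.sin (t / ε), ?_, by simp, ?_, fun t => hball ?_⟩
  · exact contDiff_const.mul (Real.contDiff_sin.comp (contDiff_id.div_const ε))
  · have h := ((hasDerivAt_id (0 : ℝ)).div_const ε).sin.const_mul ε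
    simpa [hε0.ne'] using h
  · beta_reduce
    rw [mem_ball_iff_norm, add_sub_cancel_left, norm_smul, Real.norm_eq_abs, abs_mul,
      abs_of_pos hε0]
    calc ε * |Real.sin (t / ε)| * ‖v‖ ≤ ε * 1 * (‖v‖ + 1) := by
          gcongr
          · exact Real.abs_sin_le_one _
          · linarith
      _ = r / 2 := by rw [hε]; field_simp
      _ < r := by linarith

/-- Every tangent vector is the velocity of a smooth curve. -/
theorem exists_curve [IsManifold 𝓘(ℝ, E) ∞ M] (x : M) (v : E) :
    ∃ γ : ℝ → M, ContMDiff 𝓘(ℝ, ℝ) 𝓘(ℝ, E) ∞ γ ∧ γ 0 = x ∧ mD ℝ E γ 0 1 = v := by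
  have : IsManifold 𝓘(ℝ, E) 1 M := .of_le (n := ∞) (by norm_cast)
  set φ := extChartAt 𝓘(ℝ, E) x with hφ
  obtain ⟨s, hs, hs0, hs1, hsU⟩ := exists_contDiff_curve (isOpen_extChartAt_target (I := 𝓘(ℝ, E)) x)
    (mem_extChartAt_target x) v
  have hc : ContDiff ℝ ∞ fun t => φ x + s t • v := contDiff_const.add (hs.smul contDiff_const)
  refine ⟨fun t => φ.symm (φ x + s t • v), ?_, ?_, ?_⟩
  · exact (contMDiffOn_extChartAt_symm x).comp_contMDiff hc.contMDiff hsU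
  · simp [hs0, φ]
  · have h1 := mdifferentiableAt_extChartAt_symm' x (mem_extChartAt_target (I := 𝓘(ℝ, E)) x)
    have h2 : HasFDerivAt (fun t => φ x + s t • v) (ContinuousLinearMap.toSpanSingleton ℝ v) 0 := by
      simpa using ((hs1.smul_const v).const_add (φ x)).hasFDerivAt
    rw [mD_comp ℝ E E (f := fun t => φ x + s t • v) (y := φ x) (by simp [hs0]) h1
      h2.differentiableAt.mdifferentiableAt, h2.mD_eq, mD_extChartAt_symm_self]
    simp

end Existence

/-! ### Left invariant derivatives and the Lie bracket -/

section Group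

variable {E : Type*} [NormedAddCommGroup E] [NormedSpace ℝ E]
  {G : Type*} [TopologicalSpace G] [ChartedSpace E G] [Group G] [LieGroup 𝓘(ℝ, E) ∞ G]
  {K : Type*} [NormedAddCommGroup K] [NormedSpace ℝ K]

variable (E) in
/-- The derivatives of `f` along the left invariant vector fields. -/
def leftDeriv (f : G → K) (g : G) : E →L[ℝ] K := mD E K (fun x => f (g * x)) 1

theorem mdiffAt_mul_left (g x : G) : MDifferentiableAt 𝓘(ℝ, E) 𝓘(ℝ, E) (fun y => g * y) x :=
  (contMDiff_mul_left (I := 𝓘(ℝ, E)) (n := ∞) (a := g)).mdiffAt x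

theorem leftDeriv_eq {f : G → K} (hf : ContMDiff 𝓘(ℝ, E) 𝓘(ℝ, K) ∞ f) (g : G) :
    leftDeriv E f g = (mD E K f g).comp (mD E E (fun x => g * x) 1) :=
  mD_comp E E K (mul_one g) (hf.mdiffAt g) (mdiffAt_mul_left g 1)

theorem leftDeriv_one (f : G → K) : leftDeriv E f 1 = mD E K f 1 := by
  simp [leftDeriv]

theorem contMDiff_leftDeriv {f : G → K} (hf : ContMDiff 𝓘(ℝ, E) 𝓘(ℝ, K) ∞ f) :
    ContMDiff 𝓘(ℝ, E) 𝓘(ℝ, E →L[ℝ] K) ∞ (leftDeriv E f) := by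
  have : IsManifold 𝓘(ℝ, E) ∞ G := LieGroup.toContMDiffMul.toIsManifold
  exact contMDiff_mD_param_vector (f := fun g x => f (g * x)) (hf.comp (contMDiff_mul _ _)) 1

variable (G) in
/-- The Lie bracket of the Lie algebra of `G`, on the model space. -/
def groupBracket (X Y : E) : E :=
  Bracket.bracket (L := GroupLieAlgebra 𝓘(ℝ, E) G) (M := GroupLieAlgebra 𝓘(ℝ, E) G) X Y

/-- The commutator of left invariant vector fields, as derivations at the identity. -/
theorem leftDeriv_leftDeriv_sub [CompleteSpace E] {f : G → ℝ}
    (hf : ContMDiff 𝓘(ℝ, E) 𝓘(ℝ, ℝ) ∞ f)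
    (X Y : E) :
    mD E (E →L[ℝ] ℝ) (leftDeriv E f) (1 : G) X Y - mD E (E →L[ℝ] ℝ) (leftDeriv E f) (1 : G) Y X =
      mD E ℝ f (1 : G) (groupBracket G X Y) := by
  have hM : IsManifold 𝓘(ℝ, E) ∞ G := LieGroup.toContMDiffMul.toIsManifold
  have : IsManifold 𝓘(ℝ, E) 1 G := .of_le (n := ∞) (by norm_cast)
  have : IsManifold 𝓘(ℝ, E) 2 G := .of_le (n := ∞) (by norm_cast)
  set φ := extChartAt 𝓘(ℝ, E) (1 : G) with hφ
  -- The left invariant field with value `Z` at `1`, written in the chart at `1`.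
  let V : E → E → E := fun Z y => (mD E E φ.symm y).inverse (mD E E (fun x => φ.symm y * x) 1 Z)
  have h1 : φ.symm (φ 1) = 1 := extChartAt_to_inv (I := 𝓘(ℝ, E)) (1 : G)
  have hid : mD E E φ.symm (φ 1) = ContinuousLinearMap.id ℝ E := mD_extChartAt_symm_self 1
  have hV : ∀ Z : GroupLieAlgebra 𝓘(ℝ, E) G,
      VectorField.mpullbackWithin 𝓘(ℝ, E) 𝓘(ℝ, E) φ.symm (mulInvariantVectorField Z)
      (Set.range 𝓘(ℝ, E)) = V Z := fun Z => by
    rw [modelWithCornersSelf_coe, Set.range_id]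
    ext y
    rw [VectorField.mpullbackWithin_apply, mfderivWithin_univ]
    rfl
  have huniv : φ.symm ⁻¹' Set.univ ∩ Set.range 𝓘(ℝ, E) = Set.univ := by simp
  have hbr : ∀ X Y : GroupLieAlgebra 𝓘(ℝ, E) G,
      ⁅X, Y⁆ = VectorField.lieBracket ℝ (V X) (V Y) (φ 1) := fun X Y => by
    rw [GroupLieAlgebra.bracket_def, VectorField.mlieBracket,
      VectorField.mlieBracketWithin_apply, hV, hV, huniv, VectorField.lieBracketWithin_univ]
    have hid' : mD E E φ (1 : G) = ContinuousLinearMap.id ℝ E := mfderiv_extChartAt_self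
    change (mD E E φ (1 : G)).inverse (VectorField.lieBracket ℝ (V X) (V Y) (φ 1)) = _
    rw [hid', ContinuousLinearMap.inverse_id]
    rfl
  have hVd : ∀ Z : GroupLieAlgebra 𝓘(ℝ, E) G, DifferentiableAt ℝ (V Z) (φ 1) := fun Z => by
    have h := (mdifferentiableAt_mulInvariantVectorField Z
      (g := (1 : G))).mdifferentiableWithinAt (s := Set.univ)
      |>.differentiableWithinAt_mpullbackWithin_vectorField
    rwa [hV, huniv, differentiableWithinAt_univ] at h
  have hV0 : ∀ Z, V Z (φ 1) = Z := fun Z => by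
    have h : ∀ g : G, g = 1 → mD E E (fun x => g * x) 1 Z = Z := by
      rintro g rfl
      simp only [one_mul]
      rw [mD_id]
      rfl
    change (mD E E φ.symm (φ 1)).inverse (mD E E (fun x => φ.symm (φ 1) * x) 1 Z) = Z
    rw [hid, ContinuousLinearMap.inverse_id, h _ h1]
    rfl
  set fh : E → ℝ := fun y => f (φ.symm y) with hfh
  have hfh' : ContDiffAt ℝ ∞ fh (φ 1) := (hf.exists_contDiffOn_chart (1 : G)).contDiffAt
    (extChartAt_target_mem_nhds 1)
  have hD : ∀ y ∈ φ.target, ∀ Z : E,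
      leftDeriv E f (φ.symm y) Z = fderiv ℝ fh y (V Z y) := fun y hy Z => by
    have hinv : (mD E E φ.symm y).IsInvertible := by
      have := isInvertible_mfderivWithin_extChartAt_symm hy
      rwa [modelWithCornersSelf_coe, Set.range_id, mfderivWithin_univ] at this
    rw [leftDeriv_eq hf, ← mD_eq_fderiv, hfh,
      mD_comp E E ℝ rfl (hf.mdiffAt _) (mdifferentiableAt_extChartAt_symm' 1 hy)]
    refine congrArg (mD E ℝ f (φ.symm y)) ?_
    exact (hinv.self_apply_inverse _).symm
  -- A Hessian term plus a first-order term. The Hessian is symmetric and cancels in the commutator;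
  -- the first-order terms form the bracket of `V X` and `V Y`.
  have hDD : ∀ Z Z' : E, mD E (E →L[ℝ] ℝ) (leftDeriv E f) (1 : G) Z Z' =
      fderiv ℝ (fderiv ℝ fh) (φ 1) Z Z' + fderiv ℝ fh (φ 1) (fderiv ℝ (V Z') (φ 1) Z) := by
    intro Z Z'
    have e1 : fderiv ℝ (fun y => leftDeriv E f (φ.symm y)) (φ 1) =
        mD E (E →L[ℝ] ℝ) (leftDeriv E f) (1 : G) := by
      rw [← mD_eq_fderiv, mD_comp E E (E →L[ℝ] ℝ) h1 ((contMDiff_leftDeriv hf).mdiffAt 1)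
        (mdifferentiableAt_extChartAt_symm' 1 (mem_extChartAt_target 1)), hid,
        ContinuousLinearMap.comp_id]
    have d1 : DifferentiableAt ℝ (fun y => leftDeriv E f (φ.symm y)) (φ 1) :=
      (((contMDiff_leftDeriv hf).exists_contDiffOn_chart (1 : G)).contDiffAt
        (extChartAt_target_mem_nhds 1)).differentiableAt (by simp)
    have d2 : DifferentiableAt ℝ (fderiv ℝ fh) (φ 1) :=
      (hfh'.fderiv_right (m := 1) (by norm_cast)).differentiableAt (by simp)
    have e2 : (fun y => leftDeriv E f (φ.symm y) Z') =ᶠ[nhds (φ 1)]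
        fun y => fderiv ℝ fh y (V Z' y) := by
      filter_upwards [extChartAt_target_mem_nhds (I := 𝓘(ℝ, E)) (1 : G)] with y hy
      exact hD y hy Z'
    have e3 := (d1.hasFDerivAt.clm_apply (hasFDerivAt_const Z' (φ 1))).fderiv
    have e4 := (d2.hasFDerivAt.clm_apply (hVd Z').hasFDerivAt).fderiv
    rw [e2.fderiv_eq, e4, e1] at e3
    have e5 := congrArg (fun T : E →L[ℝ] ℝ => T Z) e3
    simp only [add_apply, ContinuousLinearMap.comp_apply,
      ContinuousLinearMap.flip_apply, hV0, zero_apply, map_zero, zero_add] at e5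
    rw [← e5, add_comm]
  have hsymm : IsSymmSndFDerivAt ℝ fh (φ 1) := hfh'.isSymmSndFDerivAt
    (by rw [minSmoothness_of_isRCLikeNormedField]; norm_cast)
  have hf1 : fderiv ℝ fh (φ 1) = mD E ℝ f (1 : G) := by
    rw [← mD_eq_fderiv, hfh, mD_comp E E ℝ h1 (hf.mdiffAt _)
      (mdifferentiableAt_extChartAt_symm' 1 (mem_extChartAt_target 1)), hid,
        ContinuousLinearMap.comp_id]
  rw [hDD, hDD, hsymm.eq X Y, show groupBracket G X Y = _ from hbr X Y, VectorField.lieBracket,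
    hV0, hV0, hf1, map_sub]
  ring

end Group

theorem mD_prodMk_space {F K K' : Type*} [NormedAddCommGroup F] [NormedSpace ℝ F]
    {M : Type*} [TopologicalSpace M] [ChartedSpace F M] [NormedAddCommGroup K] [NormedSpace ℝ K]
    [NormedAddCommGroup K'] [NormedSpace ℝ K'] {f : M → K} {g : M → K'} {x : M}
    (hf : MDifferentiableAt 𝓘(ℝ, F) 𝓘(ℝ, K) f x) (hg : MDifferentiableAt 𝓘(ℝ, F) 𝓘(ℝ, K') g x) :
    mD F (K × K') (fun y => (f y, g y)) x = (mD F K f x).prod (mD F K' g x) := by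
  have h := (hf.hasMFDerivAt.prodMk hg.hasMFDerivAt).mfderiv
  rw [mD, modelWithCornersSelf_prod, ← chartedSpaceSelf_prod]
  exact h

/-! ### Bivector fields in the model space, and naturality of the bracket -/

section Bivector

variable {F : Type*} [NormedAddCommGroup F] [NormedSpace ℝ F]
  {M : Type*} [TopologicalSpace M] [ChartedSpace F M]

namespace BivectorField

/-- The value of a bivector field at a point, on the dual of the model space. -/
def form (π : BivectorField F M) (x : M) : DualForm F := π.toFun x

theorem form_self (π : BivectorField F M) (x : M) (α : F →L[ℝ] ℝ) : π.form x α α = 0 :=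
  π.alternating x α

@[ext] theorem ext_form {π π' : BivectorField F M} (h : ∀ x, π.form x = π'.form x) : π = π' := by
  cases π
  cases π'
  congr
  exact funext h

theorem bracket_apply (π : BivectorField F M) (f g : M → ℝ) (x : M) :
    π.bracket f g x = π.form x (mD F ℝ f x) (mD F ℝ g x) := rfl

theorem contMDiff_bracket (π : BivectorField F M) {f g : M → ℝ}
    (hf : ContMDiff 𝓘(ℝ, F) 𝓘(ℝ, ℝ) ∞ f) (hg : ContMDiff 𝓘(ℝ, F) 𝓘(ℝ, ℝ) ∞ g) :
    ContMDiff 𝓘(ℝ, F) 𝓘(ℝ, ℝ) ∞ (π.bracket f g) :=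
  π.smooth f g hf hg

theorem invariantUnder_iff (π : BivectorField F M) (φ : M → M) :
    π.InvariantUnder φ ↔ ∀ (x : M) (α β : F →L[ℝ] ℝ),
      π.form x (α.comp (mD F F φ x)) (β.comp (mD F F φ x)) = π.form (φ x) α β := Iff.rfl

theorem bracket_comp {π : BivectorField F M} {φ : M → M} (hπ : π.InvariantUnder φ)
    (hφ : ContMDiff 𝓘(ℝ, F) 𝓘(ℝ, F) ∞ φ) {f g : M → ℝ}
    (hf : ContMDiff 𝓘(ℝ, F) 𝓘(ℝ, ℝ) ∞ f) (hg : ContMDiff 𝓘(ℝ, F) 𝓘(ℝ, ℝ) ∞ g) :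
    (π.bracket (fun x => f (φ x)) fun x => g (φ x)) = fun x => π.bracket f g (φ x) := by
  ext x
  rw [bracket_apply, mD_comp F F ℝ rfl (hf.mdiffAt _) (hφ.mdiffAt x),
    mD_comp F F ℝ rfl (hg.mdiffAt _) (hφ.mdiffAt x), (invariantUnder_iff π φ).1 hπ, bracket_apply]

/-- The Jacobiator of three functions. -/
def jacobiator (π : BivectorField F M) (f g h : M → ℝ) (x : M) : ℝ :=
  π.bracket f (π.bracket g h) x + π.bracket g (π.bracket h f) x + π.bracket h (π.bracket f g) x

/-- This reduces the Jacobi identity on a homogeneous space to the base point. -/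
theorem jacobiator_comp {π : BivectorField F M} {φ : M → M} (hπ : π.InvariantUnder φ)
    (hφ : ContMDiff 𝓘(ℝ, F) 𝓘(ℝ, F) ∞ φ) {f g h : M → ℝ}
    (hf : ContMDiff 𝓘(ℝ, F) 𝓘(ℝ, ℝ) ∞ f) (hg : ContMDiff 𝓘(ℝ, F) 𝓘(ℝ, ℝ) ∞ g)
    (hh : ContMDiff 𝓘(ℝ, F) 𝓘(ℝ, ℝ) ∞ h) (x : M) :
    π.jacobiator (fun x => f (φ x)) (fun x => g (φ x)) (fun x => h (φ x)) x =
      π.jacobiator f g h (φ x) := by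
  simp only [jacobiator]
  rw [bracket_comp hπ hφ hg hh, bracket_comp hπ hφ hh hf, bracket_comp hπ hφ hf hg,
    bracket_comp hπ hφ hf (π.contMDiff_bracket hg hh),
    bracket_comp hπ hφ hg (π.contMDiff_bracket hh hf),
    bracket_comp hπ hφ hh (π.contMDiff_bracket hf hg)]

end BivectorField

end Bivector

/-! ### The Jacobiator of a left invariant bivector field -/

section LeftInvariant

variable {E : Type*} [NormedAddCommGroup E] [NormedSpace ℝ E] [FiniteDimensional ℝ E]
  {G : Type*} [TopologicalSpace G] [ChartedSpace E G] [Group G] [LieGroup 𝓘(ℝ, E) ∞ G]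

/-- The bracket of functions on a Lie group defined by the left invariant bivector field with value
`B` at the identity. -/
def leftBracket (B : DualForm E) (f g : G → ℝ) (x : G) : ℝ :=
  B (leftDeriv E f x) (leftDeriv E g x)

theorem leftBracket_eq (B : DualForm E) (f g : G → ℝ) :
    leftBracket B f g = fun x =>
      leftDeriv E g x (LinearMap.toContinuousLinearMap B.sharp (leftDeriv E f x)) := by
  ext x
  exact (B.apply_sharp _ _).symm

theorem contMDiff_leftBracket (B : DualForm E) {f g : G → ℝ}
    (hf : ContMDiff 𝓘(ℝ, E) 𝓘(ℝ, ℝ) ∞ f) (hg : ContMDiff 𝓘(ℝ, E) 𝓘(ℝ, ℝ) ∞ g) :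
    ContMDiff 𝓘(ℝ, E) 𝓘(ℝ, ℝ) ∞ (leftBracket B f g) := by
  rw [leftBracket_eq]
  exact (contMDiff_leftDeriv hg).clm_apply
    ((LinearMap.toContinuousLinearMap B.sharp).contMDiff.comp (contMDiff_leftDeriv hf))

/-- The product rule for `{f, g} = dg(f^#)`: in the left trivialization `B` is constant, so only `f`
and `g` are differentiated. Skew-symmetry turns the term with `df` differentiated into the same
shape, with a minus sign. -/
theorem mD_leftBracket {B : DualForm E} (hB : ∀ α, B α α = 0) {f g : G → ℝ}
    (hf : ContMDiff 𝓘(ℝ, E) 𝓘(ℝ, ℝ) ∞ f) (hg : ContMDiff 𝓘(ℝ, E) 𝓘(ℝ, ℝ) ∞ g) (X : E) :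
    mD E ℝ (leftBracket B f g) 1 X =
      mD E (E →L[ℝ] ℝ) (leftDeriv E g) (1 : G) X (B.sharp (mD E ℝ f (1 : G))) -
      mD E (E →L[ℝ] ℝ) (leftDeriv E f) (1 : G) X (B.sharp (mD E ℝ g (1 : G))) := by
  set S := LinearMap.toContinuousLinearMap B.sharp
  let Φ : (E →L[ℝ] ℝ) × (E →L[ℝ] ℝ) → ℝ := fun q => q.2 (S q.1)
  have hΦ : HasFDerivAt Φ _ (leftDeriv E f (1 : G), leftDeriv E g (1 : G)) :=
    hasFDerivAt_snd.clm_apply (S.hasFDerivAt.comp _ hasFDerivAt_fst)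
  have hpair : MDifferentiableAt 𝓘(ℝ, E) 𝓘(ℝ, (E →L[ℝ] ℝ) × (E →L[ℝ] ℝ))
      (fun x => (leftDeriv E f x, leftDeriv E g x)) (1 : G) :=
    ((contMDiff_leftDeriv hf).prodMk_space (contMDiff_leftDeriv hg)).mdiffAt 1
  have hpair' : mD E ((E →L[ℝ] ℝ) × (E →L[ℝ] ℝ))
      (fun x => (leftDeriv E f x, leftDeriv E g x)) (1 : G) =
      (mD E (E →L[ℝ] ℝ) (leftDeriv E f) (1 : G)).prod
        (mD E (E →L[ℝ] ℝ) (leftDeriv E g) (1 : G)) :=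
    mD_prodMk_space ((contMDiff_leftDeriv hf).mdiffAt 1) ((contMDiff_leftDeriv hg).mdiffAt 1)
  have h1 : leftBracket B f g = fun x => Φ (leftDeriv E f x, leftDeriv E g x) :=
    leftBracket_eq B f g
  have h2 := mD_comp E ((E →L[ℝ] ℝ) × (E →L[ℝ] ℝ)) ℝ
    (f := fun x => (leftDeriv E f x, leftDeriv E g x)) (x := (1 : G)) rfl
    hΦ.differentiableAt.mdifferentiableAt hpair
  rw [h1, h2, hΦ.mD_eq, hpair', ← leftDeriv_one f, ← leftDeriv_one g]
  set T := mD E (E →L[ℝ] ℝ) (leftDeriv E f) (1 : G) X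
  change leftDeriv E g (1 : G) (B.sharp T) + _ = _
  rw [B.apply_sharp, DualForm.skew hB, ← B.apply_sharp, neg_add_eq_sub]
  rfl

/-- The Jacobiator of a left invariant bivector field. -/
theorem leftBracket_jacobi [CompleteSpace E] {B : DualForm E} (hB : ∀ α, B α α = 0)
    {f g h : G → ℝ} (hf : ContMDiff 𝓘(ℝ, E) 𝓘(ℝ, ℝ) ∞ f) (hg : ContMDiff 𝓘(ℝ, E) 𝓘(ℝ, ℝ) ∞ g)
    (hh : ContMDiff 𝓘(ℝ, E) 𝓘(ℝ, ℝ) ∞ h) :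
    leftBracket B f (leftBracket B g h) 1 + leftBracket B g (leftBracket B h f) 1 +
        leftBracket B h (leftBracket B f g) 1 =
      mD E ℝ h (1 : G)
        (groupBracket G (B.sharp (mD E ℝ f (1 : G))) (B.sharp (mD E ℝ g (1 : G)))) +
      mD E ℝ f (1 : G)
        (groupBracket G (B.sharp (mD E ℝ g (1 : G))) (B.sharp (mD E ℝ h (1 : G)))) +
      mD E ℝ g (1 : G)
        (groupBracket G (B.sharp (mD E ℝ h (1 : G))) (B.sharp (mD E ℝ f (1 : G)))) := by
  have key : ∀ a b : G → ℝ, leftBracket B a b 1 = mD E ℝ b (1 : G) (B.sharp (mD E ℝ a (1 : G))) :=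
    fun a b => by rw [leftBracket, leftDeriv_one, leftDeriv_one, B.apply_sharp]
  -- Each of `f`, `g`, `h` occurs in two second derivatives with opposite signs and exchanged
  -- arguments, that is, in one commutator.
  rw [key, key, key, mD_leftBracket hB hg hh, mD_leftBracket hB hh hf, mD_leftBracket hB hf hg,
    ← leftDeriv_leftDeriv_sub hf, ← leftDeriv_leftDeriv_sub hg, ← leftDeriv_leftDeriv_sub hh]
  ring

end LeftInvariant

/-! ### Equivariant projections, a common frame for `G → G ⧸ H` and for the identity of `G` -/

/-- A smooth equivariant projection of a Lie group onto a homogeneous space. -/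
structure IsEquivariantProjection (E F : Type*) [NormedAddCommGroup E] [NormedSpace ℝ E]
    [NormedAddCommGroup F] [NormedSpace ℝ F] {G M : Type*} [TopologicalSpace G] [ChartedSpace E G]
    [Group G] [TopologicalSpace M] [ChartedSpace F M] [MulAction G M] (p : G → M) : Prop where
  contMDiff : ContMDiff 𝓘(ℝ, E) 𝓘(ℝ, F) ∞ p
  surjective : Function.Surjective p
  mD_surjective : Function.Surjective (mD E F p 1)
  descend : ∀ f : M → ℝ, ContMDiff 𝓘(ℝ, E) 𝓘(ℝ, ℝ) ∞ (fun g => f (p g)) →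
    ContMDiff 𝓘(ℝ, F) 𝓘(ℝ, ℝ) ∞ f
  map_mul : ∀ g x : G, p (g * x) = g • p x
  contMDiff_smul : ∀ g : G, ContMDiff 𝓘(ℝ, F) 𝓘(ℝ, F) ∞ fun x : M => g • x

namespace IsEquivariantProjection

variable {E F : Type*} [NormedAddCommGroup E] [NormedSpace ℝ E]
  [NormedAddCommGroup F] [NormedSpace ℝ F] {G M : Type*} [TopologicalSpace G] [ChartedSpace E G]
  [Group G] [LieGroup 𝓘(ℝ, E) ∞ G] [TopologicalSpace M] [ChartedSpace F M] [MulAction G M]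
  {p : G → M}

theorem smul_map_one (hp : IsEquivariantProjection E F p) (g : G) : g • p 1 = p g := by
  rw [← hp.map_mul, mul_one]

/-- The function `x ↦ f (p (g * x)) = f (g • p x)` is differentiated at `1` in two ways. This links
covectors moved to the base point with left invariant derivatives on `G`. -/
theorem mD_comp_smul (hp : IsEquivariantProjection E F p) {f : M → ℝ}
    (hf : ContMDiff 𝓘(ℝ, F) 𝓘(ℝ, ℝ) ∞ f) (g : G) :
    ((mD F ℝ f (p g)).comp (mD F F (fun x : M => g • x) (p 1))).comp (mD E F p 1) =
      leftDeriv E (fun x => f (p x)) g := by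
  rw [leftDeriv, ← mD_comp F F ℝ (hp.smul_map_one g) (hf.mdiffAt _)
    ((hp.contMDiff_smul g).mdiffAt _), ← mD_comp E F ℝ (g := fun x => f (g • x)) (f := p) rfl
    ((hf.comp (hp.contMDiff_smul g)).mdiffAt _) (hp.contMDiff.mdiffAt 1)]
  simp only [hp.map_mul]

theorem mD_mul_smul (hp : IsEquivariantProjection E F p) (g h : G) :
    mD F F (fun x : M => (g * h) • x) (p 1) =
      (mD F F (fun x : M => g • x) (p h)).comp (mD F F (fun x : M => h • x) (p 1)) := by
  rw [← mD_comp F F F (hp.smul_map_one h) ((hp.contMDiff_smul g).mdiffAt _)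
    ((hp.contMDiff_smul h).mdiffAt _)]
  simp only [mul_smul]

/-- An invariant bivector field is determined by its value at the base point. -/
theorem form_eq (hp : IsEquivariantProjection E F p) {π : BivectorField F M}
    (hπ : ∀ g : G, π.InvariantUnder fun x => g • x) (g : G) (α β : F →L[ℝ] ℝ) :
    π.form (p g) α β = π.form (p 1) (α.comp (mD F F (fun x : M => g • x) (p 1)))
      (β.comp (mD F F (fun x : M => g • x) (p 1))) := by
  rw [(π.invariantUnder_iff _).1 (hπ g), hp.smul_map_one]

theorem eq_of_form_eq (hp : IsEquivariantProjection E F p) {π π' : BivectorField F M}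
    (hπ : ∀ g : G, π.InvariantUnder fun x => g • x)
    (hπ' : ∀ g : G, π'.InvariantUnder fun x => g • x) (h : π.form (p 1) = π'.form (p 1)) :
    π = π' := by
  refine BivectorField.ext_form fun x => ?_
  obtain ⟨g, rfl⟩ := hp.surjective x
  ext α β
  rw [hp.form_eq hπ, hp.form_eq hπ', h]

variable [FiniteDimensional ℝ E] [FiniteDimensional ℝ F]

/-- A bivector on `F`, transported to `E` along a linear map `σ : F → E`. -/
def lift (B : DualForm F) (s : F →L[ℝ] E) : DualForm E :=
  B.compl₁₂ (ContinuousLinearMap.compL ℝ F E ℝ |>.flip s).toLinearMap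
    (ContinuousLinearMap.compL ℝ F E ℝ |>.flip s).toLinearMap

theorem lift_apply (B : DualForm F) (s : F →L[ℝ] E) (α β : E →L[ℝ] ℝ) :
    lift B s α β = B (α.comp s) (β.comp s) := rfl

theorem sharp_lift (B : DualForm F) (s : F →L[ℝ] E) (α : E →L[ℝ] ℝ) :
    (lift B s).sharp α = s (B.sharp (α.comp s)) :=
  ext_of_forall_dual fun β => by
    rw [DualForm.apply_sharp, lift_apply, ← DualForm.apply_sharp B]
    rfl

/-- Lifting the bivector along a linear section `s` of `T_e p` makes it left invariant on `G`. The
choice of `s` is harmless: differentials of pulled back functions factor through `T_e p`, and `T_e p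
∘ s = id`. -/
theorem bracket_map (hp : IsEquivariantProjection E F p) {π : BivectorField F M}
    (hπ : ∀ g : G, π.InvariantUnder fun x => g • x) {s : F →L[ℝ] E}
    (hs : (mD E F p 1).comp s = ContinuousLinearMap.id ℝ F) {f h : M → ℝ}
    (hf : ContMDiff 𝓘(ℝ, F) 𝓘(ℝ, ℝ) ∞ f) (hh : ContMDiff 𝓘(ℝ, F) 𝓘(ℝ, ℝ) ∞ h) :
    (fun g => π.bracket f h (p g)) =
      leftBracket (lift (π.form (p 1)) s) (fun x => f (p x)) fun x => h (p x) := by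
  ext g
  rw [BivectorField.bracket_apply, hp.form_eq hπ, leftBracket, lift_apply, ← hp.mD_comp_smul hf,
    ← hp.mD_comp_smul hh, ContinuousLinearMap.comp_assoc _ _ s, hs,
    ContinuousLinearMap.comp_assoc _ _ s, hs, ContinuousLinearMap.comp_id,
    ContinuousLinearMap.comp_id]

/-- The Poisson condition of an invariant bivector field, at the base point. -/
theorem isPoisson_iff [CompleteSpace E] [T2Space M] [IsManifold 𝓘(ℝ, F) ∞ M]
    (hp : IsEquivariantProjection E F p) {π : BivectorField F M}
    (hπ : ∀ g : G, π.InvariantUnder fun x => g • x) {𝔪 : Submodule ℝ E}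
    (hτ : ∀ v, ∃ u ∈ 𝔪, mD E F p 1 u = v) (hinj : ∀ u ∈ 𝔪, mD E F p 1 u = 0 → u = 0) :
    π.IsPoisson ↔ ∀ (α β γ : F →L[ℝ] ℝ) (u v w : E), u ∈ 𝔪 → v ∈ 𝔪 → w ∈ 𝔪 →
      IsSharpLift (π.form (p 1)) (mD E F p 1) α u → IsSharpLift (π.form (p 1)) (mD E F p 1) β v →
      IsSharpLift (π.form (p 1)) (mD E F p 1) γ w →
        γ (mD E F p 1 (groupBracket G u v)) + α (mD E F p 1 (groupBracket G v w)) +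
          β (mD E F p 1 (groupBracket G w u)) = 0 := by
  set τ := mD E F p 1
  set B := π.form (p 1)
  have hB : ∀ α, B α α = 0 := π.form_self (p 1)
  -- The section is taken with values in `𝔪`, so that `s (α^#)` is the only lift of `α^#` in `𝔪`.
  obtain ⟨s, hs, hs𝔪⟩ : ∃ s : F →L[ℝ] E, τ.comp s = ContinuousLinearMap.id ℝ F ∧ ∀ v, s v ∈ 𝔪 := by
    obtain ⟨ρ, hρ⟩ := (τ.toLinearMap ∘ₗ 𝔪.subtype).exists_rightInverse_of_surjective
      (LinearMap.range_eq_top.2 fun v => by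
        obtain ⟨u, hu, e⟩ := hτ v
        exact ⟨⟨u, hu⟩, e⟩)
    refine ⟨LinearMap.toContinuousLinearMap (𝔪.subtype ∘ₗ ρ), ?_, fun v => (ρ v).2⟩
    ext v
    exact LinearMap.congr_fun hρ v
  have hsτ : ∀ v, τ (s v) = v := fun v => congrArg (fun T : F →L[ℝ] F => T v) hs
  have huniq : ∀ (α : F →L[ℝ] ℝ) (u : E), u ∈ 𝔪 → IsSharpLift B τ α u → s (B.sharp α) = u := by
    intro α u hu hα
    refine sub_eq_zero.1 (hinj _ (𝔪.sub_mem (hs𝔪 _) hu) ?_)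
    rw [map_sub, hsτ, isSharpLift_iff.1 hα, sub_self]
  have hJ : ∀ f g h : M → ℝ, ContMDiff 𝓘(ℝ, F) 𝓘(ℝ, ℝ) ∞ f → ContMDiff 𝓘(ℝ, F) 𝓘(ℝ, ℝ) ∞ g →
      ContMDiff 𝓘(ℝ, F) 𝓘(ℝ, ℝ) ∞ h → π.jacobiator f g h (p 1) =
      mD F ℝ h (p 1) (τ (groupBracket G (s (B.sharp (mD F ℝ f (p 1))))
        (s (B.sharp (mD F ℝ g (p 1))))))
      + mD F ℝ f (p 1) (τ (groupBracket G (s (B.sharp (mD F ℝ g (p 1))))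
        (s (B.sharp (mD F ℝ h (p 1))))))
      + mD F ℝ g (p 1) (τ (groupBracket G (s (B.sharp (mD F ℝ h (p 1))))
        (s (B.sharp (mD F ℝ f (p 1))))))
      := by
    intro f g h hf hg hh
    have e : ∀ a b : M → ℝ, ContMDiff 𝓘(ℝ, F) 𝓘(ℝ, ℝ) ∞ a → ContMDiff 𝓘(ℝ, F) 𝓘(ℝ, ℝ) ∞ b →
        π.bracket a b (p 1) =
          leftBracket (lift B s) (fun x => a (p x)) (fun x => b (p x)) (1 : G) :=
      fun a b ha hb => congrFun (hp.bracket_map hπ hs ha hb) 1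
    have e' : ∀ a : M → ℝ, ContMDiff 𝓘(ℝ, F) 𝓘(ℝ, ℝ) ∞ a →
        mD E ℝ (fun x => a (p x)) 1 = (mD F ℝ a (p 1)).comp τ := fun a ha =>
      mD_comp E F ℝ rfl (ha.mdiffAt _) (hp.contMDiff.mdiffAt 1)
    rw [BivectorField.jacobiator, e _ _ hf (π.contMDiff_bracket hg hh),
      e _ _ hg (π.contMDiff_bracket hh hf), e _ _ hh (π.contMDiff_bracket hf hg),
      hp.bracket_map hπ hs hg hh, hp.bracket_map hπ hs hh hf, hp.bracket_map hπ hs hf hg,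
      leftBracket_jacobi (B := lift B s) (f := fun x => f (p x))
        (g := fun x => g (p x)) (h := fun x => h (p x))
        (fun α => hB _) (hf.comp hp.contMDiff) (hg.comp hp.contMDiff) (hh.comp hp.contMDiff),
      e' f hf, e' g hg, e' h hh]
    simp only [sharp_lift, ContinuousLinearMap.comp_assoc _ _ s, hs, ContinuousLinearMap.comp_id]
    rfl
  constructor
  · intro hPoi α β γ u v w hu hv hw hα hβ hγ
    obtain ⟨f, hf, rfl⟩ := exists_contMDiff_mD_eq (p 1) α
    obtain ⟨g, hg, rfl⟩ := exists_contMDiff_mD_eq (p 1) β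
    obtain ⟨h, hh, rfl⟩ := exists_contMDiff_mD_eq (p 1) γ
    have := hJ f g h hf hg hh
    rw [huniq _ u hu hα, huniq _ v hv hβ, huniq _ w hw hγ] at this
    rw [← this]
    exact hPoi f g h hf hg hh (p 1)
  · intro hcond f g h hf hg hh x
    -- Invariance carries the Jacobiator at `p a` to the base point, with the functions translated
    -- by `a`.
    obtain ⟨a, rfl⟩ := hp.surjective x
    have ha := hp.contMDiff_smul a
    have := BivectorField.jacobiator_comp (hπ a) ha hf hg hh (p 1)
    rw [hp.smul_map_one] at this
    change π.jacobiator f g h (p a) = 0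
    rw [← this, hJ (fun x => f (a • x)) (fun x => g (a • x)) (fun x => h (a • x)) (hf.comp ha)
      (hg.comp ha) (hh.comp ha)]
    refine hcond _ _ _ _ _ _ (hs𝔪 _) (hs𝔪 _) (hs𝔪 _) ?_ ?_ ?_ <;>
    exact isSharpLift_iff.2 (hsτ _)

/-- The extension of a bivector at the base point to an invariant bivector field. -/
theorem exists_bivectorField (hp : IsEquivariantProjection E F p) (B : DualForm F)
    (hB : ∀ α, B α α = 0)
    (hinv : ∀ h : G, p h = p 1 → ∀ α β : F →L[ℝ] ℝ,
      B (α.comp (mD F F (fun x : M => h • x) (p 1))) (β.comp (mD F F (fun x : M => h • x) (p 1)))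
        = B α β) :
    ∃ π : BivectorField F M, (∀ g : G, π.InvariantUnder fun x => g • x) ∧ π.form (p 1) = B := by
  obtain ⟨s, hs⟩ : ∃ s : F →L[ℝ] E, (mD E F p 1).comp s = ContinuousLinearMap.id ℝ F := by
    obtain ⟨ρ, hρ⟩ := (mD E F p 1).toLinearMap.exists_rightInverse_of_surjective
      (LinearMap.range_eq_top.2 hp.mD_surjective)
    refine ⟨LinearMap.toContinuousLinearMap ρ, ?_⟩
    ext v
    exact LinearMap.congr_fun hρ v
  let D : G → F →L[ℝ] F := fun g => mD F F (fun x : M => g • x) (p 1)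
  -- Two group elements over the same point differ by an element of the stabilizer, under which `B`
  -- is invariant.
  have hwd : ∀ g h : G, p g = p h → ∀ α β : F →L[ℝ] ℝ,
      B (α.comp (D g)) (β.comp (D g)) = B (α.comp (D h)) (β.comp (D h)) := by
    intro g h e α β
    have h1 : p (h⁻¹ * g) = p 1 := by rw [hp.map_mul, e, ← hp.map_mul, inv_mul_cancel]
    have h2 : D g = (D h).comp (D (h⁻¹ * g)) := by
      have := hp.mD_mul_smul h (h⁻¹ * g)
      rwa [mul_inv_cancel_left, h1] at this
    rw [h2, ← ContinuousLinearMap.comp_assoc, ← ContinuousLinearMap.comp_assoc, hinv _ h1]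
  let q : M → G := Function.surjInv hp.surjective
  have hq : ∀ x, p (q x) = x := Function.surjInv_eq hp.surjective
  let fm : ∀ x : M, DualForm F := fun x => B.compl₁₂
    (ContinuousLinearMap.compL ℝ F F ℝ |>.flip (D (q x))).toLinearMap
    (ContinuousLinearMap.compL ℝ F F ℝ |>.flip (D (q x))).toLinearMap
  have hfm : ∀ g α β, fm (p g) α β = B (α.comp (D g)) (β.comp (D g)) := fun g α β =>
    hwd _ _ (hq _) α β
  refine ⟨⟨fm, fun x α => hB _, fun f h hf hh => hp.descend _ ?_⟩, fun g x α β => ?_, ?_⟩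
  -- The chosen representatives `q x` need not vary continuously. Smoothness is tested after pulling
  -- back to `G`, where the bracket is a left invariant one.
  · convert contMDiff_leftBracket (lift B s) (hf.comp hp.contMDiff) (hh.comp hp.contMDiff) using 1
    ext g
    refine (hfm g (mD F ℝ f (p g)) (mD F ℝ h (p g))).trans ?_
    have h1 := hp.mD_comp_smul hf g
    have h2 := hp.mD_comp_smul hh g
    simp only [Function.comp_def]
    rw [leftBracket, lift_apply, ← h1, ← h2, ContinuousLinearMap.comp_assoc _ _ s, hs,
    ContinuousLinearMap.comp_assoc _ _ s, hs, ContinuousLinearMap.comp_id,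
    ContinuousLinearMap.comp_id]
  · obtain ⟨x, rfl⟩ := hp.surjective x
    have h1 := hfm x ((α : F →L[ℝ] ℝ).comp (mD F F (fun x : M => g • x) (p x)))
      ((β : F →L[ℝ] ℝ).comp (mD F F (fun x : M => g • x) (p x)))
    have h2 := hfm (g * x) α β
    rw [hp.map_mul] at h2
    refine h1.trans (Eq.trans ?_ h2.symm)
    rw [show D (g * x) = _ from hp.mD_mul_smul g x]
    rfl
  · ext α β
    refine (hfm 1 α β).trans ?_
    exact hinv 1 rfl α β

end IsEquivariantProjection

/-! ### Local sections and fibres of submersions -/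

section Submersion

variable {E F : Type*} [NormedAddCommGroup E] [NormedSpace ℝ E]
  [NormedAddCommGroup F] [NormedSpace ℝ F] {M N : Type*} [TopologicalSpace M] [ChartedSpace E M]
  [IsManifold 𝓘(ℝ, E) ∞ M] [TopologicalSpace N] [ChartedSpace F N] [IsManifold 𝓘(ℝ, F) ∞ N]
  {p : M → N}

/-- The local normal form of a submersion. -/
theorem _root_.Manifold.IsSubmersion.exists_charts (hp : Manifold.IsSubmersion 𝓘(ℝ, E) 𝓘(ℝ, F) ∞ p)
    (x : M) : ∃ (φ : OpenPartialHomeomorph M E) (ψ : OpenPartialHomeomorph N F)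
      (s : F →L[ℝ] E) (e : E →L[ℝ] F), (∀ v, e (s v) = v) ∧ x ∈ φ.source ∧ p x ∈ ψ.source ∧
      φ ∈ IsManifold.maximalAtlas 𝓘(ℝ, E) ∞ M ∧ ψ ∈ IsManifold.maximalAtlas 𝓘(ℝ, F) ∞ N ∧
      (∀ z ∈ φ.source, p z ∈ ψ.source) ∧ ∀ w ∈ φ.target, ψ (p (φ.symm w)) = e w := by
  obtain ⟨K, _, _, hK⟩ := hp
  have h := hK x
  refine ⟨h.domChart, h.codChart,
    h.equiv.symm.toContinuousLinearMap.comp (ContinuousLinearMap.inl ℝ F K),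
    (ContinuousLinearMap.fst ℝ F K).comp h.equiv.toContinuousLinearMap, fun v => by simp,
    h.mem_domChart_source, h.mem_codChart_source, h.domChart_mem_maximalAtlas,
    h.codChart_mem_maximalAtlas, h.source_subset_preimage_source, fun w hw => ?_⟩
  have hw' : w ∈ (h.domChart.extend 𝓘(ℝ, E)).target := by simpa using hw
  simpa using h.writtenInCharts hw'

/-- Submersions have smooth local sections. -/
theorem _root_.Manifold.IsSubmersion.exists_local_section
    (hp : Manifold.IsSubmersion 𝓘(ℝ, E) 𝓘(ℝ, F) ∞ p) (x : M) :
    ∃ s : N → M, s (p x) = x ∧ ContMDiffAt 𝓘(ℝ, F) 𝓘(ℝ, E) ∞ s (p x) ∧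
      ∀ᶠ y in nhds (p x), p (s y) = y := by
  obtain ⟨φ, ψ, s, e, hes, hx, hpx, hφ, hψ, hmap, hw⟩ := hp.exists_charts x
  -- In the charts `p` is the linear map `e`, so an affine section through `φ x` is given by the
  -- right inverse `s` of `e`.
  let q : N → E := fun y => φ x + s (ψ y - ψ (p x))
  have hq0 : q (p x) = φ x := by simp [q]
  have hqs : ContMDiffAt 𝓘(ℝ, F) 𝓘(ℝ, E) ∞ q (p x) := by
    have h1 : ContMDiffAt 𝓘(ℝ, F) 𝓘(ℝ, F) ∞ ψ (p x) := contMDiffAt_of_mem_maximalAtlas hψ hpx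
    have h2 : ContDiff ℝ ∞ fun v => φ x + s (v - ψ (p x)) :=
      contDiff_const.add (s.contDiff.comp (contDiff_id.sub contDiff_const))
    exact h2.contMDiff.contMDiffAt.comp (p x) h1
  have hqt : ∀ᶠ y in nhds (p x), q y ∈ φ.target :=
    hqs.continuousAt.eventually_mem (by
      rw [hq0]
      exact φ.open_target.mem_nhds (φ.map_source hx))
  have hex : e (φ x) = ψ (p x) := by
    rw [← hw _ (φ.map_source hx), φ.left_inv hx]
  refine ⟨fun y => φ.symm (q y), by simp only [hq0, φ.left_inv hx], ?_, ?_⟩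
  · refine ContMDiffAt.comp (p x) (g := φ.symm) ?_ hqs
    rw [hq0]
    exact contMDiffAt_symm_of_mem_maximalAtlas hφ (φ.map_source hx)
  · filter_upwards [hqt, ψ.open_source.mem_nhds hpx] with y hy hyψ
    refine ψ.injOn (hmap _ (φ.map_target hy)) hyψ ?_
    rw [hw _ hy, map_add, hes, hex, add_sub_cancel]

theorem _root_.Manifold.IsSubmersion.mD_surjective
    (hp : Manifold.IsSubmersion 𝓘(ℝ, E) 𝓘(ℝ, F) ∞ p) (x : M) :
    Function.Surjective (mD E F p x) := by
  obtain ⟨s, hs0, hs, hps⟩ := hp.exists_local_section x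
  intro v
  refine ⟨mD F E s (p x) v, ?_⟩
  have h := mD_comp F E F (f := s) (g := p) hs0 (hp.contMDiff.mdiffAt x)
    (hs.mdifferentiableAt (by simp))
  rw [mD_congr F F (g := fun y => y) hps, mD_id] at h
  exact (congrArg (fun T : F →L[ℝ] F => T v) h).symm

/-- Near `p x` the map `f` is `f ∘ p` composed with a smooth local section. -/
theorem _root_.Manifold.IsSubmersion.contMDiff_of_comp {K P : Type*} [NormedAddCommGroup K]
    [NormedSpace ℝ K] [TopologicalSpace P] [ChartedSpace K P]
    (hp : Manifold.IsSubmersion 𝓘(ℝ, E) 𝓘(ℝ, F) ∞ p) (hsurj : Function.Surjective p) {f : N → P}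
    (hf : ContMDiff 𝓘(ℝ, E) 𝓘(ℝ, K) ∞ fun x => f (p x)) : ContMDiff 𝓘(ℝ, F) 𝓘(ℝ, K) ∞ f := by
  intro y
  obtain ⟨x, rfl⟩ := hsurj y
  obtain ⟨s, hs0, hs, hps⟩ := hp.exists_local_section x
  have h1 : ContMDiffAt 𝓘(ℝ, F) 𝓘(ℝ, K) ∞ (fun y => f (p (s y))) (p x) :=
    (hf.contMDiffAt (x := s (p x))).comp (p x) hs
  refine h1.congr_of_eventuallyEq ?_
  filter_upwards [hps] with y hy
  rw [hy]

/-- Vertical vectors are velocities of curves in the fibre. -/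
theorem _root_.Manifold.IsSubmersion.exists_curve_in_fibre
    (hp : Manifold.IsSubmersion 𝓘(ℝ, E) 𝓘(ℝ, F) ∞ p) (x : M) (v : E) (hv : mD E F p x v = 0) :
    ∃ γ : ℝ → M, ContMDiff 𝓘(ℝ, ℝ) 𝓘(ℝ, E) ∞ γ ∧ (∀ t, p (γ t) = p x) ∧ γ 0 = x ∧
      mD ℝ E γ 0 1 = v := by
  obtain ⟨φ, ψ, s, e, hes, hx, hpx, hφ, hψ, hmap, hw⟩ := hp.exists_charts x
  have hφd : MDifferentiableAt 𝓘(ℝ, E) 𝓘(ℝ, E) φ x :=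
    (contMDiffAt_of_mem_maximalAtlas hφ hx).mdifferentiableAt (by simp)
  have hφd' : MDifferentiableAt 𝓘(ℝ, E) 𝓘(ℝ, E) φ.symm (φ x) :=
    (contMDiffAt_symm_of_mem_maximalAtlas hφ (φ.map_source hx)).mdifferentiableAt (by simp)
  have hψd : MDifferentiableAt 𝓘(ℝ, F) 𝓘(ℝ, F) ψ (p x) :=
    (contMDiffAt_of_mem_maximalAtlas hψ hpx).mdifferentiableAt (by simp)
  set w := mD E E φ x v with hwdef
  have hew : e w = 0 := by
    have h1 : (fun z => ψ (p z)) =ᶠ[nhds x] fun z => e (φ z) := by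
      filter_upwards [φ.open_source.mem_nhds hx] with z hz
      rw [← hw _ (φ.map_source hz), φ.left_inv hz]
    have h2 := mD_congr E F h1
    rw [mD_comp E F F rfl hψd (hp.contMDiff.mdiffAt x),
      mD_comp E E F (g := e) rfl e.differentiableAt.mdifferentiableAt hφd,
      e.hasFDerivAt.mD_eq] at h2
    have h3 := congrArg (fun T : E →L[ℝ] F => T v) h2
    refine h3.symm.trans ?_
    change mD F F ψ (p x) (mD E F p x v) = 0
    rw [hv, map_zero]
  -- In the charts the fibre is a level set of `e`, so a curve on the line through `φ x` in a
  -- direction `w` of its kernel stays in the fibre.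
  obtain ⟨c, hc, hc0, hc1, hct⟩ := exists_contDiff_curve φ.open_target (φ.map_source hx) w
  have hcc : ContDiff ℝ ∞ fun t => φ x + c t • w := contDiff_const.add (hc.smul contDiff_const)
  refine ⟨fun t => φ.symm (φ x + c t • w), ?_, fun t => ?_, ?_, ?_⟩
  · exact (contMDiffOn_symm_of_mem_maximalAtlas hφ).comp_contMDiff hcc.contMDiff hct
  · refine ψ.injOn (hmap _ (φ.map_target (hct t))) hpx ?_
    rw [hw _ (hct t), map_add, map_smul, hew, smul_zero, add_zero, ← hw _ (φ.map_source hx),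
      φ.left_inv hx]
  · simp [hc0, φ.left_inv hx]
  · have h2 : HasFDerivAt (fun t => φ x + c t • w) (ContinuousLinearMap.toSpanSingleton ℝ w) 0 := by
      simpa using ((hc1.smul_const w).const_add (φ x)).hasFDerivAt
    rw [mD_comp ℝ E E (f := fun t => φ x + c t • w) (y := φ x) (by simp [hc0]) hφd'
      h2.differentiableAt.mdifferentiableAt, h2.mD_eq]
    have h3 : (fun z => φ.symm (φ z)) =ᶠ[nhds x] fun z => z := by
      filter_upwards [φ.open_source.mem_nhds hx] with z hz
      rw [φ.left_inv hz]
    have h4 := mD_congr E E h3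
    rw [mD_comp E E E rfl hφd' hφd, mD_id] at h4
    have h5 := congrArg (fun T : E →L[ℝ] E => T v) h4
    simpa using h5

end Submersion

/-! ### The projection onto `G ⧸ H` -/

section Quotient

variable {E F : Type*} [NormedAddCommGroup E] [NormedSpace ℝ E]
  [NormedAddCommGroup F] [NormedSpace ℝ F] {G : Type*} [TopologicalSpace G] [ChartedSpace E G]
  [Group G] [LieGroup 𝓘(ℝ, E) ∞ G] {H : Subgroup G} [ChartedSpace F (G ⧸ H)]

theorem isEquivariantProjection_mk [hF : IsHomogeneousManifold E H F] :
    IsEquivariantProjection E F (QuotientGroup.mk : G → G ⧸ H) := by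
  have hM : IsManifold 𝓘(ℝ, E) ∞ G := LieGroup.toContMDiffMul.toIsManifold
  have := hF.isManifold
  have hp := hF.isSubmersion
  have hs : Function.Surjective (QuotientGroup.mk : G → G ⧸ H) := QuotientGroup.mk_surjective
  refine ⟨hp.contMDiff, hs, hp.mD_surjective 1, fun f hf => hp.contMDiff_of_comp hs hf,
    fun g x => rfl, fun g => hp.contMDiff_of_comp hs ?_⟩
  exact hp.contMDiff.comp (contMDiff_mul_left (a := g))

/-- Curves in `H` are collapsed by the projection; conversely a vertical vector at `1` is the
velocity of a curve in the fibre, which is `H`. -/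
theorem mem_subgroupLieAlgebra_iff [hF : IsHomogeneousManifold E H F]
    (X : GroupLieAlgebra 𝓘(ℝ, E) G) :
    X ∈ subgroupLieAlgebra H ↔ mD E F (QuotientGroup.mk : G → G ⧸ H) 1 X = 0 := by
  have hM : IsManifold 𝓘(ℝ, E) ∞ G := LieGroup.toContMDiffMul.toIsManifold
  have := hF.isManifold
  have hp := hF.isSubmersion
  constructor
  · rintro ⟨γ, hγ, hH, h0, hv⟩
    have h1 : (fun t => (QuotientGroup.mk (γ t) : G ⧸ H)) = fun _ => ((1 : G) : G ⧸ H) := by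
      ext t
      exact QuotientGroup.eq.2 (by simpa using hH t)
    have h2 := mD_comp ℝ E F h0 (hp.contMDiff.mdiffAt 1) (hγ.mdiffAt 0)
    rw [h1, mD_const] at h2
    have h3 := congrArg (fun T : ℝ →L[ℝ] F => T 1) h2
    rw [← hv]
    exact h3.symm
  · intro hX
    obtain ⟨γ, hγ, hH, h0, hv⟩ := hp.exists_curve_in_fibre 1 X hX
    exact ⟨γ, hγ, fun t => by simpa using QuotientGroup.eq.1 (hH t).symm, h0, hv⟩

/-- For `a ∈ H` the cosets `a x a⁻¹ H` and `a x H` coincide; differentiate at `x = 1`. -/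
theorem mD_mk_Ad [hF : IsHomogeneousManifold E H F] {a : G} (ha : a ∈ H) (u : E) :
    mD E F (QuotientGroup.mk : G → G ⧸ H) 1 (mD E E (fun x : G => a * x * a⁻¹) 1 u) =
      mD F F (fun x : G ⧸ H => a • x) ((1 : G) : G ⧸ H)
        (mD E F (QuotientGroup.mk : G → G ⧸ H) 1 u) := by
  have hp := isEquivariantProjection_mk (E := E) (F := F) (H := H)
  have hc : ContMDiff 𝓘(ℝ, E) 𝓘(ℝ, E) ∞ fun x : G => a * x * a⁻¹ :=
    (contMDiff_mul_right (a := a⁻¹)).comp (contMDiff_mul_left (a := a))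
  have h1 := mD_comp E E F (f := fun x : G => a * x * a⁻¹) (x := 1) (y := 1) (by simp)
    (hp.contMDiff.mdiffAt 1) (hc.mdiffAt 1)
  have h2 := mD_comp E F F (f := (QuotientGroup.mk : G → G ⧸ H)) (x := 1) rfl
    ((hp.contMDiff_smul a).mdiffAt _) (hp.contMDiff.mdiffAt 1)
  have h3 : (fun x : G => ((a * x * a⁻¹ : G) : G ⧸ H)) = fun x : G => a • (x : G ⧸ H) := by
    ext x
    exact QuotientGroup.eq.2 (by simpa [mul_assoc] using ha)
  rw [h3, h2] at h1
  exact (congrArg (fun T : E →L[ℝ] F => T u) h1).symm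

end Quotient

/-- A relation which is total and functional in both directions is the graph of an equivalence. -/
theorem exists_equiv_of_relation {A B : Type*} (R : A → B → Prop) (h₁ : ∀ a, ∃ b, R a b)
    (h₂ : ∀ a b b', R a b → R a b' → b = b') (h₃ : ∀ b, ∃ a, R a b)
    (h₄ : ∀ a a' b, R a b → R a' b → a = a') : ∃ e : A ≃ B, ∀ a, R a (e a) := by
  choose f hf using h₁
  choose g hg using h₃
  exact ⟨⟨f, g, fun a => h₄ _ _ _ (hg (f a)) (hf a), fun b => h₂ _ _ _ (hf (g b)) (hg b)⟩, hf⟩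

/-! ### The adjoint action as a homomorphism -/

section Adjoint

variable {E : Type*} [NormedAddCommGroup E] [NormedSpace ℝ E]
  {G : Type*} [TopologicalSpace G] [ChartedSpace E G] [Group G] [LieGroup 𝓘(ℝ, E) ∞ G]

theorem contMDiff_conj (a b : G) : ContMDiff 𝓘(ℝ, E) 𝓘(ℝ, E) ∞ fun x : G => a * x * b :=
  (contMDiff_mul_right (a := b)).comp (contMDiff_mul_left (a := a))

variable (E) in
/-- The adjoint action on the model space. -/
def adE (a : G) : E →L[ℝ] E := mD E E (fun x : G => a * x * a⁻¹) 1

theorem adE_one : adE E (1 : G) = ContinuousLinearMap.id ℝ E := by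
  simp only [adE, one_mul, inv_one, mul_one]
  exact mD_id E 1

theorem adE_mul (a b : G) : adE E (a * b) = (adE E a).comp (adE E b) := by
  rw [adE, adE, adE, ← mD_comp E E E (f := fun x : G => b * x * b⁻¹) (y := 1) (by simp)
    ((contMDiff_conj a a⁻¹).mdiffAt 1) ((contMDiff_conj b b⁻¹).mdiffAt 1)]
  simp only [mul_inv_rev, mul_assoc]

theorem Ad_Ad_inv (a : G) (u : GroupLieAlgebra 𝓘(ℝ, E) G) : Ad a (Ad a⁻¹ u) = u := by
  have h := adE_mul (E := E) a a⁻¹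
  rw [mul_inv_cancel, adE_one] at h
  exact (congrArg (fun T : E →L[ℝ] E => T u) h).symm

end Adjoint

/-! ### Invariant Poisson structures on reductive homogeneous spaces -/

section Reductive

variable {E F : Type*} [NormedAddCommGroup E] [NormedSpace ℝ E] [FiniteDimensional ℝ E]
  [NormedAddCommGroup F] [NormedSpace ℝ F] [FiniteDimensional ℝ F]
  {G : Type*} [TopologicalSpace G] [ChartedSpace E G]
  [Group G] [LieGroup 𝓘(ℝ, E) ∞ G] {H : Subgroup G} [ChartedSpace F (G ⧸ H)]

instance : FiniteDimensional ℝ (GroupLieAlgebra 𝓘(ℝ, E) G) :=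
  inferInstanceAs (FiniteDimensional ℝ E)

variable (E F H) in
/-- The tangent map of the projection, with values in the model space. -/
def quotientMap : GroupLieAlgebra 𝓘(ℝ, E) G →L[ℝ] F :=
  mD E F (QuotientGroup.mk : G → G ⧸ H) 1

variable {𝔪 : Submodule ℝ (GroupLieAlgebra 𝓘(ℝ, E) G)}

theorem isPairOf_iff {π : BivectorField F (G ⧸ H)} {P : SymplecticSubspace H 𝔪} :
    IsPairOf π P ↔ IsLinearPairOf 𝔪 (quotientMap E F H) (π.form ((1 : G) : G ⧸ H)) P.W P.form :=
  Iff.rfl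

variable [hF : IsHomogeneousManifold E H F]

/-- With the next lemma, this is the identification of `𝔪` with the tangent space at the base point:
`T_e p` is onto with kernel `𝔥`, and `𝔪` is a complement of `𝔥`. -/
theorem exists_mem_quotientMap_eq (h𝔪 : IsCompl 𝔪 (subgroupLieAlgebra H)) (v : F) :
    ∃ u ∈ 𝔪, quotientMap E F H u = v := by
  obtain ⟨X, hX⟩ : ∃ X : GroupLieAlgebra 𝓘(ℝ, E) G, quotientMap E F H X = v :=
    (isEquivariantProjection_mk (E := E) (F := F) (H := H)).mD_surjective v
  obtain ⟨u, hu, w, hw, e⟩ := Submodule.mem_sup.1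
    (show X ∈ 𝔪 ⊔ subgroupLieAlgebra H by rw [h𝔪.sup_eq_top]; exact Submodule.mem_top)
  have h0 : quotientMap E F H w = 0 := (mem_subgroupLieAlgebra_iff w).1 hw
  rw [← e, map_add, h0, add_zero] at hX
  exact ⟨u, hu, hX⟩

theorem eq_zero_of_quotientMap_eq_zero (h𝔪 : IsCompl 𝔪 (subgroupLieAlgebra H)) :
    ∀ u ∈ 𝔪, quotientMap E F H u = 0 → u = 0 := fun u hu h0 =>
  h𝔪.disjoint.eq_bot ▸ (⟨hu, (mem_subgroupLieAlgebra_iff u).2 h0⟩ :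
    u ∈ 𝔪 ⊓ subgroupLieAlgebra H) |> (Submodule.mem_bot ℝ).1

/-- The two brackets differ by an element of `𝔥`, the kernel of `T_e p`. This replaces the bracket
of `𝔤` in the Jacobiator by `[·,·]_𝔪`. -/
theorem quotientMap_bracketOn (h𝔪 : IsCompl 𝔪 (subgroupLieAlgebra H)) [CompleteSpace E]
    (x y : GroupLieAlgebra 𝓘(ℝ, E) G) :
    quotientMap E F H (bracketOn h𝔪 x y) = quotientMap E F H ⁅x, y⁆ := by
  have h : (⁅x, y⁆ - bracketOn h𝔪 x y) ∈ subgroupLieAlgebra H := by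
    rw [← Submodule.projectionOnto_apply_eq_zero_iff h𝔪, map_sub, bracketOn,
      Submodule.projectionOnto_apply_left, sub_self]
  have h0 := (mem_subgroupLieAlgebra_iff (F := F) _).1 h
  have h1 : quotientMap E F H (⁅x, y⁆ - bracketOn h𝔪 x y) = 0 := h0
  rw [map_sub, sub_eq_zero] at h1
  exact h1.symm

variable (F) in
/-- The isotropy representation on the tangent space at the base point. -/
def isotropy (H : Subgroup G) [ChartedSpace F (G ⧸ H)] (a : G) : F →L[ℝ] F :=
  mD F F (fun x : G ⧸ H => a • x) ((1 : G) : G ⧸ H)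

theorem quotientMap_Ad {a : G} (ha : a ∈ H) (u : GroupLieAlgebra 𝓘(ℝ, E) G) :
    quotientMap E F H (Ad a u) = isotropy F H a (quotientMap E F H u) :=
  mD_mk_Ad (E := E) (F := F) ha u

theorem mk_eq_mk_one {a : G} : (a : G ⧸ H) = ((1 : G) : G ⧸ H) ↔ a ∈ H := by
  rw [eq_comm, QuotientGroup.eq, inv_one, one_mul]

omit hF in
theorem isotropy_inv_apply (hp : IsEquivariantProjection E F (QuotientGroup.mk : G → G ⧸ H))
    {a : G} (ha : a ∈ H) (v : F) :
    isotropy F H a⁻¹ (isotropy F H a v) = v := by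
  have h := hp.mD_mul_smul a⁻¹ a
  rw [inv_mul_cancel, mk_eq_mk_one.2 ha] at h
  have h1 : (fun x : G ⧸ H => (1 : G) • x) = fun x => x := funext fun x => one_smul G x
  rw [h1, mD_id] at h
  exact (congrArg (fun T : F →L[ℝ] F => T v) h).symm

omit hF in
theorem form_isotropy (hp : IsEquivariantProjection E F (QuotientGroup.mk : G → G ⧸ H))
    {π : BivectorField F (G ⧸ H)} (hπ : IsGInvariant π) {a : G} (ha : a ∈ H)
    (α β : F →L[ℝ] ℝ) :
    π.form ((1 : G) : G ⧸ H) (α.comp (isotropy F H a)) (β.comp (isotropy F H a)) =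
      π.form ((1 : G) : G ⧸ H) α β := by
  have h := hp.form_eq hπ a α β
  rw [mk_eq_mk_one.2 ha] at h
  exact h.symm

theorem exists_isPairOf (h𝔪 : IsCompl 𝔪 (subgroupLieAlgebra H)) (hAd : IsAdInvariant H 𝔪)
    {π : BivectorField F (G ⧸ H)} (hπ : IsGInvariant π) :
    ∃ P : SymplecticSubspace H 𝔪, IsPairOf π P := by
  have hp := isEquivariantProjection_mk (E := E) (F := F) (H := H)
  obtain ⟨W, σ, hW, hσ, hσ', hP⟩ := exists_isLinearPairOf
    (π.form_self ((1 : G) : G ⧸ H)) (exists_mem_quotientMap_eq h𝔪)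
    (eq_zero_of_quotientMap_eq_zero (F := F) h𝔪)
  have hmem : IsAdInvariant H W := fun a ha u hu =>
    hP.mem_of_invariant (quotientMap_Ad ha) (isotropy_inv_apply hp ha)
      (form_isotropy hp hπ ha) (hAd a ha) hu
  exact ⟨⟨W, hW, hmem, σ, hσ, hσ', fun a ha u v => hP.form_of_invariant (quotientMap_Ad ha)
    (isotropy_inv_apply hp ha) (form_isotropy hp hπ ha) u v _ _⟩, hP⟩

theorem exists_isGInvariant_isPairOf (h𝔪 : IsCompl 𝔪 (subgroupLieAlgebra H))
    (P : SymplecticSubspace H 𝔪) :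
    ∃ π : BivectorField F (G ⧸ H), IsGInvariant π ∧ IsPairOf π P := by
  have hp := isEquivariantProjection_mk (E := E) (F := F) (H := H)
  obtain ⟨B, hB, hP⟩ := exists_dualForm_isLinearPairOf P.le P.alt P.nondegenerate
    (eq_zero_of_quotientMap_eq_zero (F := F) h𝔪)
  obtain ⟨π, hπ, rfl⟩ := hp.exists_bivectorField B hB fun a ha α β => by
    have ha' : a ∈ H := mk_eq_mk_one.1 ha
    exact hP.invariant_of_form P.nondegenerate (exists_mem_quotientMap_eq h𝔪)
      (A := Ad a) (A₁ := Ad a⁻¹) (quotientMap_Ad ha') (P.adInvariant a ha')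
      (P.adInvariant a⁻¹ (H.inv_mem ha')) (Ad_Ad_inv a) (P.form_adInvariant a ha') α β
  exact ⟨π, hπ, hP⟩

theorem IsPairOf.eq_of_left {π π' : BivectorField F (G ⧸ H)} {P : SymplecticSubspace H 𝔪}
    (h𝔪 : IsCompl 𝔪 (subgroupLieAlgebra H)) (hπ : IsGInvariant π) (hπ' : IsGInvariant π')
    (h : IsPairOf π P) (h' : IsPairOf π' P) : π = π' :=
  (isEquivariantProjection_mk (E := E) (F := F) (H := H)).eq_of_form_eq hπ hπ'
    ((isPairOf_iff.1 h).form_unique P.nondegenerate h' (exists_mem_quotientMap_eq h𝔪))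

theorem IsPairOf.eq_of_right {π : BivectorField F (G ⧸ H)} {P P' : SymplecticSubspace H 𝔪}
    (h : IsPairOf π P) (h' : IsPairOf π P') : P = P' := by
  obtain ⟨W, hW, hAd, σ, h1, h2, h3⟩ := P
  obtain ⟨W', hW', hAd', σ', h1', h2', h3'⟩ := P'
  obtain ⟨rfl, hσ⟩ := (isPairOf_iff.1 h).pair_unique h'
  cases hσ
  rfl

theorem IsPairOf.isPoisson_iff [CompleteSpace E] (hH : IsClosed (H : Set G))
    {π : BivectorField F (G ⧸ H)} {P : SymplecticSubspace H 𝔪}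
    (h𝔪 : IsCompl 𝔪 (subgroupLieAlgebra H)) (hπ : IsGInvariant π)
    (h : IsPairOf π P) : π.IsPoisson ↔ P.IsCocyclePair h𝔪 := by
  -- Together with closedness of `H` this makes `G ⧸ H` Hausdorff, as the bump functions behind
  -- `exists_contMDiff_mD_eq` require.
  have : IsTopologicalGroup G := topologicalGroup_of_lieGroup 𝓘(ℝ, E) ∞
  have : IsManifold 𝓘(ℝ, F) ∞ (G ⧸ H) := hF.isManifold
  have hp := isEquivariantProjection_mk (E := E) (F := F) (H := H)
  have h1 := hp.isPoisson_iff (𝔪 := 𝔪) hπ (exists_mem_quotientMap_eq h𝔪)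
    (eq_zero_of_quotientMap_eq_zero (F := F) h𝔪)
  have h2 := (isPairOf_iff.1 h).cocycle_iff P.nondegenerate P.le (exists_mem_quotientMap_eq h𝔪)
    (eq_zero_of_quotientMap_eq_zero (F := F) h𝔪) (br := bracketOn h𝔪)
    (fun x y => (𝔪.projectionOnto _ h𝔪 ⁅x, y⁆).2) (fun x => by simp [bracketOn])
    (fun x => by simp [bracketOn])
  simp only [quotientMap_bracketOn] at h2
  exact h1.trans h2

omit [FiniteDimensional ℝ E] [ChartedSpace F (G ⧸ H)] hF in
/-- In a symmetric pair the cocycle condition is empty. -/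
theorem SymplecticSubspace.isCocyclePair_of_symmetric [CompleteSpace E]
    (h𝔪 : IsCompl 𝔪 (subgroupLieAlgebra H))
    (hsymm : ∀ x ∈ 𝔪, ∀ y ∈ 𝔪, ⁅x, y⁆ ∈ subgroupLieAlgebra H) (P : SymplecticSubspace H 𝔪) :
    P.IsCocyclePair h𝔪 := by
  have h0 : ∀ x y : P.W, bracketOn h𝔪 (x : GroupLieAlgebra 𝓘(ℝ, E) G) y = 0 := fun x y => by
    rw [bracketOn, (Submodule.projectionOnto_apply_eq_zero_iff h𝔪).2
      (hsymm x (P.le x.2) y (P.le y.2)), Submodule.coe_zero]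
  refine ⟨fun x y => by rw [h0]; exact P.W.zero_mem, fun x y z => ?_⟩
  have h1 : ∀ (x y z : P.W) (hm : bracketOn h𝔪 (x : GroupLieAlgebra 𝓘(ℝ, E) G) y ∈ P.W),
      P.form ⟨_, hm⟩ z = 0 := fun x y z hm => by
    rw [show (⟨_, hm⟩ : P.W) = 0 from Subtype.ext (h0 x y), map_zero, LinearMap.zero_apply]
  rw [h1, h1, h1, add_zero, add_zero]

/-- By irreducibility `W` is `0` or `𝔪`, so the bivector at the base point is zero or nondegenerate;
translations carry this to every point. -/
theorem isTrivial_or_nondegenerate (h𝔪 : IsCompl 𝔪 (subgroupLieAlgebra H))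
    (hAd : IsAdInvariant H 𝔪) (hirr : IsAdIrreducible H 𝔪) {π : BivectorField F (G ⧸ H)}
    (hπ : IsGInvariant π) : π.IsTrivial ∨ π.Nondegenerate := by
  have hp := isEquivariantProjection_mk (E := E) (F := F) (H := H)
  obtain ⟨P, hP⟩ := exists_isPairOf h𝔪 hAd hπ
  rw [isPairOf_iff] at hP
  set D : G → F →L[ℝ] F := fun g => mD F F (fun x : G ⧸ H => g • x) ((1 : G) : G ⧸ H)
  rcases hirr.2 P.W P.le P.adInvariant with hW | hW
  · left
    have h0 : π.form ((1 : G) : G ⧸ H) = 0 := by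
      ext α β
      obtain ⟨u, hu⟩ := hP.exists_sharpLift (exists_mem_quotientMap_eq h𝔪) α
      have hu0 : (u : GroupLieAlgebra 𝓘(ℝ, E) G) = 0 := (Submodule.mem_bot ℝ).1 (hW ▸ u.2)
      rw [← hu β, hu0, map_zero, map_zero]
      rfl
    intro x
    obtain ⟨g, rfl⟩ := hp.surjective x
    change π.form (g : G ⧸ H) = 0
    ext α β
    rw [hp.form_eq hπ, h0]
    rfl
  · right
    intro x α hα
    obtain ⟨g, rfl⟩ := hp.surjective x
    have hinv : ∀ v, mD F F (fun x : G ⧸ H => g⁻¹ • x) (g : G ⧸ H) (D g v) = v := fun v => by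
      have h := hp.mD_mul_smul g⁻¹ g
      have h1 : (fun x : G ⧸ H => (1 : G) • x) = fun x => x := funext fun x => one_smul G x
      rw [inv_mul_cancel, h1, mD_id] at h
      exact (congrArg (fun T : F →L[ℝ] F => T v) h).symm
    have hsurj : Function.Surjective (D g) :=
      (LinearMap.injective_iff_surjective (f := (D g).toLinearMap)).1
        (Function.LeftInverse.injective hinv)
    -- A degenerate covector `α` at `g • ē` is pulled back to one at `ē`. Its sharp is `0`, so it
    -- vanishes on `W = 𝔪`, hence everywhere.
    have h0 : ∀ β : F →L[ℝ] ℝ,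
        π.form ((1 : G) : G ⧸ H) ((α : F →L[ℝ] ℝ).comp (D g)) β = 0 := fun β => by
      have h1 := hp.form_eq hπ g α (β.comp (mD F F (fun x : G ⧸ H => g⁻¹ • x) (g : G ⧸ H)))
      have h2 : (β.comp (mD F F (fun x : G ⧸ H => g⁻¹ • x) (g : G ⧸ H))).comp (D g) = β := by
        ext v
        exact congrArg β (hinv v)
      rw [← h2]
      exact h1.symm.trans (hα _)
    obtain ⟨u, hu⟩ := hP.exists_sharpLift (exists_mem_quotientMap_eq h𝔪) (α.comp (D g))
    have hu0 : u = 0 := Subtype.ext <| eq_zero_of_quotientMap_eq_zero (F := F) h𝔪 u (P.le u.2) <|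
      ext_of_forall_dual fun β => by rw [hu β, h0, map_zero]
    have h3 : ∀ v, α (D g v) = 0 := fun v => by
      obtain ⟨w, hw, rfl⟩ := exists_mem_quotientMap_eq (F := F) h𝔪 v
      have := hP.form_apply ⟨w, hW.symm ▸ hw⟩ hu
      rw [hu0, map_zero] at this
      exact this.symm
    ext v
    obtain ⟨w, rfl⟩ := hsurj v
    exact h3 w

end Reductive

/-! ### Derivatives along curves and symmetry of mixed derivatives -/

section Curves

variable {E K : Type*} [NormedAddCommGroup E] [NormedSpace ℝ E]
  [NormedAddCommGroup K] [NormedSpace ℝ K]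
  {M : Type*} [TopologicalSpace M] [ChartedSpace E M]

theorem mD_apply_eq_deriv {f : M → K} (hf : ContMDiff 𝓘(ℝ, E) 𝓘(ℝ, K) ∞ f) {γ : ℝ → M}
    (hγ : ContMDiff 𝓘(ℝ, ℝ) 𝓘(ℝ, E) ∞ γ) {x : M} (h0 : γ 0 = x) :
    mD E K f x (mD ℝ E γ 0 1) = deriv (fun t => f (γ t)) 0 := by
  rw [← fderiv_apply_one_eq_deriv, ← mD_eq_fderiv, mD_comp ℝ E K h0 (hf.mdiffAt x) (hγ.mdiffAt 0)]
  rfl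

theorem deriv_deriv_comm {Φ : ℝ × ℝ → K} (hΦ : ContDiff ℝ ∞ Φ) :
    deriv (fun s => deriv (fun t => Φ (t, s)) 0) 0 =
      deriv (fun t => deriv (fun s => Φ (t, s)) 0) 0 := by
  have hd : ∀ p, HasFDerivAt Φ (fderiv ℝ Φ p) p := fun p =>
    (hΦ.differentiable (by simp) p).hasFDerivAt
  have hd2 : HasFDerivAt (fderiv ℝ Φ) (fderiv ℝ (fderiv ℝ Φ) 0) ((0 : ℝ), (0 : ℝ)) :=
    ((hΦ.fderiv_right (m := 1) (by norm_cast)).differentiable (by simp) _).hasFDerivAt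
  have h1 : ∀ t s : ℝ, HasDerivAt (fun t => (t, s)) ((1 : ℝ), (0 : ℝ)) t := fun t s =>
    (hasDerivAt_id t).prodMk (hasDerivAt_const t s)
  have h2 : ∀ t s : ℝ, HasDerivAt (fun s => (t, s)) ((0 : ℝ), (1 : ℝ)) s := fun t s =>
    (hasDerivAt_const s t).prodMk (hasDerivAt_id s)
  have e1 : ∀ s, deriv (fun t => Φ (t, s)) 0 = fderiv ℝ Φ (0, s) (1, 0) := fun s =>
    ((hd (0, s)).comp_hasDerivAt (0 : ℝ) (h1 0 s)).deriv
  have e2 : ∀ t, deriv (fun s => Φ (t, s)) 0 = fderiv ℝ Φ (t, 0) (0, 1) := fun t =>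
    ((hd (t, 0)).comp_hasDerivAt (0 : ℝ) (h2 t 0)).deriv
  simp only [e1, e2]
  have e3 := ((hd2.comp_hasDerivAt (f := fun s : ℝ => ((0 : ℝ), s)) (0 : ℝ) (h2 0 0)).clm_apply
    (hasDerivAt_const (0 : ℝ) ((1 : ℝ), (0 : ℝ)))).deriv
  have e4 := ((hd2.comp_hasDerivAt (f := fun t : ℝ => (t, (0 : ℝ))) (0 : ℝ) (h1 0 0)).clm_apply
    (hasDerivAt_const (0 : ℝ) ((0 : ℝ), (1 : ℝ)))).deriv
  simp only [map_zero, add_zero, Function.comp_def] at e3 e4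
  have hsymm : IsSymmSndFDerivAt ℝ Φ 0 := hΦ.contDiffAt.isSymmSndFDerivAt
    (by rw [minSmoothness_of_isRCLikeNormedField]; norm_cast)
  exact e3.trans ((hsymm.eq _ _).trans e4.symm)

end Curves

/-! ### The derivative of the adjoint action -/

section Adjoint

variable {E : Type*} [NormedAddCommGroup E] [NormedSpace ℝ E]
  {G : Type*} [TopologicalSpace G] [ChartedSpace E G] [Group G] [LieGroup 𝓘(ℝ, E) ∞ G]

theorem contMDiff_adE : ContMDiff 𝓘(ℝ, E) 𝓘(ℝ, E →L[ℝ] E) ∞ (adE E : G → E →L[ℝ] E) := by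
  have : IsManifold 𝓘(ℝ, E) ∞ G := LieGroup.toContMDiffMul.toIsManifold
  refine contMDiff_mD_param (f := fun a x : G => a * x * a⁻¹) (y := 1) ?_ fun a => by simp
  exact (contMDiff_fst.mul contMDiff_snd).mul contMDiff_fst.inv

/-- From `g x = (g x g⁻¹) g`: left and right translation differ by a conjugation. -/
theorem leftDeriv_eq_comp_adE {f : G → ℝ} (hf : ContMDiff 𝓘(ℝ, E) 𝓘(ℝ, ℝ) ∞ f) (g : G) :
    leftDeriv E f g = (mD E ℝ (fun x => f (x * g)) 1).comp (adE E g) := by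
  rw [leftDeriv, adE, ← mD_comp E E ℝ (g := fun x => f (x * g)) (f := fun x : G => g * x * g⁻¹)
    (by simp)
    ((hf.comp contMDiff_mul_right).mdiffAt 1) ((contMDiff_conj g g⁻¹).mdiffAt 1)]
  simp only [inv_mul_cancel_right]

/-- The derivative of the adjoint action is the Lie bracket. -/
theorem mD_adE [FiniteDimensional ℝ E] [CompleteSpace E] [T2Space G] (X Y : E) :
    mD E (E →L[ℝ] E) (adE E) (1 : G) X Y = groupBracket G X Y := by
  have : IsManifold 𝓘(ℝ, E) ∞ G := LieGroup.toContMDiffMul.toIsManifold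
  refine ext_of_forall_dual fun α => ?_
  obtain ⟨f, hf, rfl⟩ := exists_contMDiff_mD_eq (1 : G) α
  rw [← leftDeriv_leftDeriv_sub hf, eq_sub_iff_add_eq]
  -- `R` differentiates along right invariant fields, and `leftDeriv E f g = R g ∘ Ad_g`. The
  -- product rule at `1` isolates the derivative of `Ad`.
  let R : G → E →L[ℝ] ℝ := fun g => mD E ℝ (fun x => f (x * g)) 1
  have hR : ContMDiff 𝓘(ℝ, E) 𝓘(ℝ, E →L[ℝ] ℝ) ∞ R :=
    contMDiff_mD_param_vector (f := fun g x => f (x * g))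
      (hf.comp (contMDiff_snd.mul contMDiff_fst)) 1
  obtain ⟨γ, hγ, hγ0, hγX⟩ := exists_curve (1 : G) X
  obtain ⟨δ, hδ, hδ0, hδY⟩ := exists_curve (1 : G) Y
  have hL : ∀ (Q : G → E →L[ℝ] ℝ), ContMDiff 𝓘(ℝ, E) 𝓘(ℝ, E →L[ℝ] ℝ) ∞ Q →
      ∀ (Z : E) (c : ℝ → G), ContMDiff 𝓘(ℝ, ℝ) 𝓘(ℝ, E) ∞ c → c 0 = 1 →
      deriv (fun s => Q (c s) Z) 0 = mD E (E →L[ℝ] ℝ) Q (1 : G) (mD ℝ E c 0 1) Z := by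
    intro Q hQ Z c hc hc0
    have hd : DifferentiableAt ℝ (fun s => Q (c s)) 0 :=
      (hQ.comp hc).contDiff.differentiable (by simp) 0
    rw [mD_apply_eq_deriv hQ hc hc0, (hd.hasDerivAt.clm_apply (hasDerivAt_const 0 Z)).deriv,
      map_zero, add_zero]
  -- Left and right invariant fields commute: both sides are mixed derivatives of `f (δ t * γ s)`.
  have hmixed : mD E (E →L[ℝ] ℝ) R (1 : G) X Y =
      mD E (E →L[ℝ] ℝ) (leftDeriv E f) (1 : G) Y X := by
    rw [← hγX, ← hδY, ← hL R hR _ γ hγ hγ0, ← hL _ (contMDiff_leftDeriv hf) _ δ hδ hδ0]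
    have h1 : ∀ s, R (γ s) (mD ℝ E δ 0 1) = deriv (fun t => f (δ t * γ s)) 0 := fun s =>
      mD_apply_eq_deriv (f := fun x => f (x * γ s)) (hf.comp contMDiff_mul_right) hδ hδ0
    have h2 : ∀ t, leftDeriv E f (δ t) (mD ℝ E γ 0 1) = deriv (fun s => f (δ t * γ s)) 0 :=
      fun t => mD_apply_eq_deriv (f := fun x => f (δ t * x)) (hf.comp contMDiff_mul_left) hγ hγ0
    simp only [h1, h2]
    refine deriv_deriv_comm (Φ := fun p => f (δ p.1 * γ p.2)) ?_
    rw [← contMDiff_iff_contDiff]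
    exact hf.comp ((hδ.comp contDiff_fst.contMDiff).mul (hγ.comp contDiff_snd.contMDiff))
  have hprod : leftDeriv E f = fun g => (R g).comp (adE E g) := funext (leftDeriv_eq_comp_adE hf)
  have h3 : deriv (fun s => leftDeriv E f (γ s) Y) 0 =
      mD E (E →L[ℝ] ℝ) (leftDeriv E f) (1 : G) X Y := by
    rw [hL _ (contMDiff_leftDeriv hf) _ γ hγ hγ0, hγX]
  have hR1 : R 1 = mD E ℝ f 1 := by simp only [R, mul_one]
  have dR : HasDerivAt (fun s => R (γ s)) (mD E (E →L[ℝ] ℝ) R 1 X) 0 := by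
    rw [← hγX, mD_apply_eq_deriv hR hγ hγ0]
    exact ((hR.comp hγ).contDiff.differentiable (by simp) 0).hasDerivAt
  have dA : HasDerivAt (fun s => adE E (γ s)) (mD E (E →L[ℝ] E) (adE E) (1 : G) X) 0 := by
    rw [← hγX, mD_apply_eq_deriv contMDiff_adE hγ hγ0]
    exact ((contMDiff_adE.comp hγ).contDiff.differentiable (by simp) 0).hasDerivAt
  have h4 := (dR.clm_apply (dA.clm_apply (hasDerivAt_const 0 Y))).deriv
  rw [← h3, ← hmixed, hprod]
  refine Eq.trans ?_ h4.symm
  rw [hγ0, hR1, adE_one, map_zero, add_zero, add_comm]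
  rfl

end Adjoint

/-! ### Bi-invariant Poisson structures and abelian ideals -/

section BiInvariant

variable {E : Type*} [NormedAddCommGroup E] [NormedSpace ℝ E] [FiniteDimensional ℝ E]
  {G : Type*} [TopologicalSpace G] [ChartedSpace E G] [Group G] [LieGroup 𝓘(ℝ, E) ∞ G]

theorem isEquivariantProjection_id : IsEquivariantProjection E E fun x : G => x where
  contMDiff := contMDiff_id
  surjective := Function.surjective_id
  mD_surjective := by
    rw [mD_id]
    exact Function.surjective_id
  descend _ h := h
  map_mul _ _ := rfl
  contMDiff_smul _ := contMDiff_mul_left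

variable (G) in
/-- The infinitesimal adjoint action on the model space. -/
def adLie (X : E) : E →L[ℝ] E := mD E (E →L[ℝ] E) (adE E) (1 : G) X

/-- A bivector is invariant under a connected group if and only if it is so infinitesimally. -/
theorem form_adE_iff [ConnectedSpace G] (B : DualForm E) :
    (∀ (a : G) (α β : E →L[ℝ] ℝ), B (α.comp (adE E a)) (β.comp (adE E a)) = B α β) ↔
      ∀ (X : E) (α β : E →L[ℝ] ℝ), B (α.comp (adLie G X)) β + B α (β.comp (adLie G X)) = 0 := by
  have : IsManifold 𝓘(ℝ, E) ∞ G := LieGroup.toContMDiffMul.toIsManifold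
  let S := LinearMap.toContinuousLinearMap B.sharp
  let L : (E →L[ℝ] ℝ) → (E →L[ℝ] E) →L[ℝ] (E →L[ℝ] ℝ) := fun α =>
    ContinuousLinearMap.compL ℝ E E ℝ α
  let ψ : (E →L[ℝ] ℝ) → (E →L[ℝ] ℝ) → G → ℝ := fun α β g => L β (adE E g) (S (L α (adE E g)))
  have hψ : ∀ α β g, ψ α β g = B (α.comp (adE E g)) (β.comp (adE E g)) := fun α β g =>
    B.apply_sharp _ _
  have hsm : ∀ α β, ContMDiff 𝓘(ℝ, E) 𝓘(ℝ, ℝ) ∞ (ψ α β) := fun α β =>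
    ((L β).contMDiff.comp contMDiff_adE).clm_apply
      (S.contMDiff.comp ((L α).contMDiff.comp contMDiff_adE))
  -- Translating `ψ` only changes its covectors, so a derivative that vanishes at `1` for all
  -- covectors vanishes everywhere, and `ψ` is constant on the connected group.
  have hmul : ∀ α β g x, ψ α β (g * x) = ψ (α.comp (adE E g)) (β.comp (adE E g)) x :=
    fun α β g x => by rw [hψ, hψ, adE_mul]; rfl
  have hd : ∀ α β X, mD E ℝ (ψ α β) 1 X =
      B (α.comp (adLie G X)) β + B α (β.comp (adLie G X)) := fun α β X => by
    have h1 : HasFDerivAt (fun T => L β T (S (L α T))) _ (adE E (1 : G)) :=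
      (L β).hasFDerivAt.clm_apply ((S.comp (L α)).hasFDerivAt)
    have h2 := mD_comp E (E →L[ℝ] E) ℝ rfl h1.differentiableAt.mdifferentiableAt
      (contMDiff_adE.mdiffAt (1 : G))
    rw [h1.mD_eq] at h2
    refine (congrArg (fun T : E →L[ℝ] ℝ => T X) h2).trans ?_
    rw [← B.apply_sharp, ← B.apply_sharp, adE_one]
    rfl
  constructor
  · intro h X α β
    rw [← hd, show ψ α β = fun _ => B α β from funext fun g => (hψ α β g).trans (h g α β),
      mD_const, zero_apply]
  · intro h a α β
    have h0 : ∀ α β, mD E ℝ (ψ α β) 1 = 0 := fun α β => by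
      ext X
      rw [hd, h, zero_apply]
    have h1 := eq_of_mD_eq_zero (hsm α β) (fun g => by
      have e := mD_comp E E ℝ (g := fun x => ψ α β (g * x)) (f := fun x => g⁻¹ * x) (x := g)
        (inv_mul_cancel g) (((hsm α β).comp contMDiff_mul_left).mdiffAt 1) (mdiffAt_mul_left _ _)
      simp only [hmul, h0, ContinuousLinearMap.zero_comp] at e
      simpa only [← hmul, mul_inv_cancel_left] using e) a 1
    rw [hψ, hψ, adE_one] at h1
    exact h1

/-- The converse rests on `a (x y) b⁻¹ = (a x b⁻¹) (b y b⁻¹)`: in the left trivialization the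
two-sided action at any point is `Ad_b`. -/
theorem isBiInvariant_iff {π : BivectorField E G} :
    IsBiInvariant π ↔ (∀ g : G, π.InvariantUnder fun x => g • x) ∧
      ∀ (a : G) (α β : E →L[ℝ] ℝ),
        π.form 1 (α.comp (adE E a)) (β.comp (adE E a)) = π.form 1 α β := by
  constructor
  · intro h
    refine ⟨fun g => ?_, fun a α β => ?_⟩
    · have h1 := h g 1
      simp only [inv_one, mul_one] at h1
      exact h1
    · have h1 := (π.invariantUnder_iff _).1 (h a a) 1 α β
      simp only [mul_one, mul_inv_cancel] at h1
      exact h1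
  · rintro ⟨hl, had⟩ a b
    rw [π.invariantUnder_iff]
    intro x α β
    have hp := isEquivariantProjection_id (E := E) (G := G)
    have e : (mD E E (fun y : G => a * y * b⁻¹) x).comp (mD E E (fun y : G => x • y) 1) =
        (mD E E (fun y : G => (a * x * b⁻¹) • y) 1).comp (adE E b) := by
      rw [adE, ← mD_comp E E E (g := fun y : G => (a * x * b⁻¹) • y)
        (f := fun y : G => b * y * b⁻¹) (by simp) (mdiffAt_mul_left _ 1)
        ((contMDiff_conj b b⁻¹).mdiffAt 1), ← mD_comp E E E (g := fun y : G => a * y * b⁻¹)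
        (f := fun y : G => x • y) (mul_one x) ((contMDiff_conj a b⁻¹).mdiffAt x)
        (mdiffAt_mul_left x 1)]
      simp only [smul_eq_mul, mul_assoc, inv_mul_cancel_left]
    rw [hp.form_eq hl x, hp.form_eq hl (a * x * b⁻¹), ContinuousLinearMap.comp_assoc,
      ContinuousLinearMap.comp_assoc, e, ← ContinuousLinearMap.comp_assoc,
      ← ContinuousLinearMap.comp_assoc, had]

variable [CompleteSpace E]

theorem isIdealOf_iff {π : BivectorField E G} {P : SymplecticAbelianIdeal E G} :
    IsIdealOf π P ↔ IsLinearPairOf (⊤ : Submodule ℝ E) (ContinuousLinearMap.id ℝ E) (π.form 1)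
      P.W.toSubmodule P.form :=
  and_congr_left' (forall_congr' fun _ => iff_congr Iff.rfl (iff_of_eq (true_and _)).symm)

theorem groupBracket_zero_right (X : E) : groupBracket G X 0 = 0 :=
  lie_zero (L := GroupLieAlgebra 𝓘(ℝ, E) G) (M := GroupLieAlgebra 𝓘(ℝ, E) G) X

theorem groupBracket_zero_left (X : E) : groupBracket G 0 X = 0 :=
  zero_lie (L := GroupLieAlgebra 𝓘(ℝ, E) G) (M := GroupLieAlgebra 𝓘(ℝ, E) G) X

theorem groupBracket_skew (X Y : E) : groupBracket G X Y = -groupBracket G Y X :=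
  (lie_skew (L := GroupLieAlgebra 𝓘(ℝ, E) G) X Y).symm

theorem exists_mem_top_id_eq (v : E) :
    ∃ u ∈ (⊤ : Submodule ℝ E), ContinuousLinearMap.id ℝ E u = v :=
  ⟨v, trivial, rfl⟩

/-- The Poisson condition for a left invariant bivector field. -/
theorem isPoisson_iff_cocycle [T2Space G] {π : BivectorField E G}
    (hπ : ∀ g : G, π.InvariantUnder fun x => g • x) {W : Submodule ℝ E}
    {σ : LinearMap.BilinForm ℝ W} (hσ : σ.Nondegenerate)
    (h : IsLinearPairOf ⊤ (ContinuousLinearMap.id ℝ E) (π.form 1) W σ) :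
    π.IsPoisson ↔ ∃ hb : ∀ x y : W, groupBracket G (x : E) y ∈ W, ∀ x y z : W,
      σ ⟨_, hb x y⟩ z + σ ⟨_, hb z x⟩ y + σ ⟨_, hb y z⟩ x = 0 := by
  have : IsManifold 𝓘(ℝ, E) ∞ G := LieGroup.toContMDiffMul.toIsManifold
  have h1 := (isEquivariantProjection_id (E := E) (G := G)).isPoisson_iff (𝔪 := ⊤) hπ
    (by rw [mD_id]; exact exists_mem_top_id_eq) (by rw [mD_id]; exact fun _ _ h => h)
  rw [mD_id] at h1
  exact h1.trans (h.cocycle_iff hσ le_top exists_mem_top_id_eq (fun _ _ h => h)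
    (fun _ _ => trivial) groupBracket_zero_right groupBracket_zero_left)

theorem exists_isIdealOf [T2Space G] [ConnectedSpace G] {π : BivectorField E G}
    (hπ : IsBiInvariant π) (hP : π.IsPoisson) :
    ∃ P : SymplecticAbelianIdeal E G, IsIdealOf π P := by
  obtain ⟨hl, had⟩ := isBiInvariant_iff.1 hπ
  have had' := (form_adE_iff (π.form 1)).1 had
  obtain ⟨W, σ, -, hσ, hσ', h⟩ := exists_isLinearPairOf (τ := ContinuousLinearMap.id ℝ E)
    (𝔪 := ⊤) (π.form_self 1) exists_mem_top_id_eq (fun _ _ h => h)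
  have hW : ∀ (X u : E), u ∈ W → groupBracket G X u ∈ W := fun X u hu => by
    obtain ⟨-, α, hα⟩ := (h.1 u).1 hu
    rw [← mD_adE]
    exact (h.1 _).2 ⟨trivial, _, hα.derivation (had' X)⟩
  have hinv : ∀ (X : E) (u v : W), σ ⟨groupBracket G X u, hW X u u.2⟩ v +
      σ u ⟨groupBracket G X v, hW X v v.2⟩ = 0 := fun X u v => by
    obtain ⟨-, α, hα⟩ := (h.1 u).1 u.2
    obtain ⟨-, β, hβ⟩ := (h.1 v).1 v.2
    have hα' := hα.derivation (had' X)
    have hβ' := hβ.derivation (had' X)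
    rw [adLie, mD_adE] at hα' hβ'
    rw [h.2 ⟨groupBracket G X u, hW X u u.2⟩ v _ _ hα' hβ,
      h.2 u ⟨groupBracket G X v, hW X v v.2⟩ _ _ hα hβ', map_neg, map_neg, LinearMap.neg_apply,
      ← neg_add, neg_eq_zero]
    exact had' X α β
  obtain ⟨hb, hc⟩ := (isPoisson_iff_cocycle hl hσ' h).1 hP
  -- Invariance under `w` says that the terms of the cocycle identity containing `[w, u]` and `[v,
  -- w]` cancel. There remains `σ([u, v], w) = 0` for every `w ∈ W`.
  have hab : ∀ u v : W, groupBracket G (u : E) v = 0 := fun u v => by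
    refine congrArg Subtype.val (hσ'.1 ⟨_, hb u v⟩ fun w => ?_)
    have h1 := hc w u v
    have h2 := hinv w u v
    have h3 : (⟨_, hb v w⟩ : W) = -⟨_, hb w v⟩ := Subtype.ext (groupBracket_skew _ _)
    rw [h3, map_neg, LinearMap.neg_apply, hσ.neg_eq] at h1
    linarith
  exact ⟨⟨{ W with lie_mem := fun {X u} hu => hW X u hu }, hab, σ, hσ, hσ', hinv⟩,
    isIdealOf_iff.2 h⟩

/-- `ad`-invariance integrates to `Ad`-invariance on the connected group, and every term of the
cocycle identity vanishes since `W` is abelian. -/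
theorem exists_isBiInvariant_isIdealOf [T2Space G] [ConnectedSpace G]
    (P : SymplecticAbelianIdeal E G) :
    ∃ π : BivectorField E G, IsBiInvariant π ∧ π.IsPoisson ∧ IsIdealOf π P := by
  let W : Submodule ℝ E := P.W.toSubmodule
  let σ : LinearMap.BilinForm ℝ W := P.form
  have hσ : σ.Nondegenerate := P.nondegenerate
  have hW : ∀ (X u : E), u ∈ W → groupBracket G X u ∈ W := fun X u hu =>
    P.W.lie_mem (x := X) hu
  obtain ⟨B, hB, h⟩ := exists_dualForm_isLinearPairOf (τ := ContinuousLinearMap.id ℝ E)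
    (le_top : W ≤ ⊤) (σ := σ) P.alt hσ (fun _ _ h => h)
  have had := (form_adE_iff (G := G) B).2 fun X α β =>
    h.derivation_of_form hσ (adLie G X) (fun u hu => by rw [adLie, mD_adE]; exact hW X u hu)
      (fun u v => by
        have e : ∀ (u : W) (hu : adLie G X u ∈ W),
            (⟨adLie G X u, hu⟩ : W) = ⟨groupBracket G X u, hW X u u.2⟩ := fun u hu =>
          Subtype.ext (mD_adE X u)
        rw [e, e]
        exact P.form_adInvariant X u v) α β
  have hp := isEquivariantProjection_id (E := E) (G := G)
  obtain ⟨π, hπ, hπB⟩ := hp.exists_bivectorField B hB fun a ha α β => by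
    have h1 : (fun x : G => a • x) = fun x => x := funext fun x => by
      rw [show a = 1 from ha, one_smul]
    rw [h1, mD_id]
    rfl
  change π.form 1 = B at hπB
  subst hπB
  refine ⟨π, isBiInvariant_iff.2 ⟨hπ, had⟩, (isPoisson_iff_cocycle hπ hσ h).2 ?_,
    isIdealOf_iff.2 h⟩
  have hab : ∀ u v : W, groupBracket G (u : E) v = 0 := P.abelian
  refine ⟨fun u v => by rw [hab]; exact W.zero_mem, fun x y z => ?_⟩
  have h0 : ∀ (u v w : W) (hm : groupBracket G (u : E) v ∈ W), σ ⟨_, hm⟩ w = 0 :=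
    fun u v w hm => by
      rw [show (⟨_, hm⟩ : W) = 0 from Subtype.ext (hab u v), map_zero, LinearMap.zero_apply]
  rw [h0, h0, h0, add_zero, add_zero]

theorem IsIdealOf.eq_of_left {π π' : BivectorField E G} {P : SymplecticAbelianIdeal E G}
    (hπ : IsBiInvariant π) (hπ' : IsBiInvariant π') (h : IsIdealOf π P) (h' : IsIdealOf π' P) :
    π = π' :=
  (isEquivariantProjection_id (E := E) (G := G)).eq_of_form_eq (isBiInvariant_iff.1 hπ).1
    (isBiInvariant_iff.1 hπ').1
    ((isIdealOf_iff.1 h).form_unique P.nondegenerate (isIdealOf_iff.1 h') exists_mem_top_id_eq)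

theorem IsIdealOf.eq_of_right {π : BivectorField E G} {P P' : SymplecticAbelianIdeal E G}
    (h : IsIdealOf π P) (h' : IsIdealOf π P') : P = P' := by
  obtain ⟨⟨W, hW⟩, hab, σ, h1, h2, h3⟩ := P
  obtain ⟨⟨W', hW'⟩, hab', σ', h1', h2', h3'⟩ := P'
  obtain ⟨e, hσ⟩ := (isIdealOf_iff.1 h).pair_unique (isIdealOf_iff.1 h')
  have e' : W = W' := e
  subst e'
  cases hσ
  rfl

end BiInvariant

/-! ### Rotation-invariant bivector fields on spheres -/

section Sphere

variable {m : ℕ}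

/-- The differential of the inclusion of the sphere. -/
def sphereIncl (x : Metric.sphere (0 : EuclideanSpace ℝ (Fin (m + 1))) 1) :
    EuclideanSpace ℝ (Fin m) →L[ℝ] EuclideanSpace ℝ (Fin (m + 1)) :=
  mD (EuclideanSpace ℝ (Fin m)) (EuclideanSpace ℝ (Fin (m + 1))) Subtype.val x

theorem contMDiff_sphere_val : ContMDiff 𝓘(ℝ, EuclideanSpace ℝ (Fin m))
    𝓘(ℝ, EuclideanSpace ℝ (Fin (m + 1))) ∞
    (Subtype.val : Metric.sphere (0 : EuclideanSpace ℝ (Fin (m + 1))) 1 → _) :=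
  have := Fact.mk (@finrank_euclideanSpace_fin ℝ _ (m + 1))
  contMDiff_coe_sphere

theorem contMDiff_sphereMap
    (A : EuclideanSpace ℝ (Fin (m + 1)) ≃ₗᵢ[ℝ] EuclideanSpace ℝ (Fin (m + 1))) :
    ContMDiff 𝓘(ℝ, EuclideanSpace ℝ (Fin m)) 𝓘(ℝ, EuclideanSpace ℝ (Fin m)) ∞ (sphereMap A) :=
  have := Fact.mk (@finrank_euclideanSpace_fin ℝ _ (m + 1))
  ContMDiff.codRestrict_sphere
    (f := fun x : Metric.sphere (0 : EuclideanSpace ℝ (Fin (m + 1))) 1 => A x)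
    (A.toContinuousLinearEquiv.toContinuousLinearMap.contMDiff.comp contMDiff_sphere_val)
    fun x => (sphereMap A x).2

theorem sphereIncl_injective (x : Metric.sphere (0 : EuclideanSpace ℝ (Fin (m + 1))) 1) :
    Function.Injective (sphereIncl x) :=
  have := Fact.mk (@finrank_euclideanSpace_fin ℝ _ (m + 1))
  injective_mvfderiv_subtypeVal_sphere x

theorem inner_sphereIncl (x : Metric.sphere (0 : EuclideanSpace ℝ (Fin (m + 1))) 1)
    (u : EuclideanSpace ℝ (Fin m)) :
    inner ℝ (x : EuclideanSpace ℝ (Fin (m + 1))) (sphereIncl x u) = 0 := by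
  have := Fact.mk (@finrank_euclideanSpace_fin ℝ _ (m + 1))
  have h : sphereIncl x u ∈ (ℝ ∙ (x : EuclideanSpace ℝ (Fin (m + 1))))ᗮ := by
    rw [← range_mvfderiv_subtypeVal (n := m) x]
    exact ⟨u, rfl⟩
  exact Submodule.mem_orthogonal_singleton_iff_inner_right.1 h

/-- The restriction of the covector `⟨v, ·⟩` to the sphere. -/
def sphereCovector (x : Metric.sphere (0 : EuclideanSpace ℝ (Fin (m + 1))) 1) :
    EuclideanSpace ℝ (Fin (m + 1)) →ₗ[ℝ] (EuclideanSpace ℝ (Fin m) →L[ℝ] ℝ) where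
  toFun v := (innerSL ℝ v).comp (sphereIncl x)
  map_add' v w := by rw [map_add, ContinuousLinearMap.add_comp]
  map_smul' c v := by
    ext u
    simp

theorem sphereCovector_apply (x : Metric.sphere (0 : EuclideanSpace ℝ (Fin (m + 1))) 1)
    (v : EuclideanSpace ℝ (Fin (m + 1))) (u : EuclideanSpace ℝ (Fin m)) :
    sphereCovector x v u = inner ℝ v (sphereIncl x u) := rfl

theorem sphereCovector_self (x : Metric.sphere (0 : EuclideanSpace ℝ (Fin (m + 1))) 1) :
    sphereCovector x x = 0 := by
  ext u
  exact inner_sphereIncl x u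

/-- Covectors at `x` are thus ambient vectors modulo `x`, so a bivector at `x` becomes an
alternating form on the Euclidean space with `x` in its radical. -/
theorem sphereCovector_surjective (x : Metric.sphere (0 : EuclideanSpace ℝ (Fin (m + 1))) 1) :
    Function.Surjective (sphereCovector x) := by
  intro α
  obtain ⟨ρ, hρ⟩ := (sphereIncl x).toLinearMap.exists_leftInverse_of_injective
    (LinearMap.ker_eq_bot.2 (sphereIncl_injective x))
  refine ⟨(InnerProductSpace.toDual ℝ _).symm
    (LinearMap.toContinuousLinearMap (α.toLinearMap ∘ₗ ρ)), ?_⟩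
  ext u
  rw [sphereCovector_apply, InnerProductSpace.toDual_symm_apply]
  exact congrArg α (LinearMap.congr_fun hρ u)

theorem sphereCovector_comp
    (A : EuclideanSpace ℝ (Fin (m + 1)) ≃ₗᵢ[ℝ] EuclideanSpace ℝ (Fin (m + 1)))
    (x : Metric.sphere (0 : EuclideanSpace ℝ (Fin (m + 1))) 1)
    (v : EuclideanSpace ℝ (Fin (m + 1))) :
    (sphereCovector (sphereMap A x) v).comp
        (mD (EuclideanSpace ℝ (Fin m)) (EuclideanSpace ℝ (Fin m)) (sphereMap A) x) =
      sphereCovector x (A.symm v) := by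
  have h1 := mD_comp (EuclideanSpace ℝ (Fin m)) (EuclideanSpace ℝ (Fin m))
    (EuclideanSpace ℝ (Fin (m + 1))) rfl (contMDiff_sphere_val.mdiffAt (sphereMap A x))
    ((contMDiff_sphereMap A).mdiffAt x)
  have h2 := mD_comp (EuclideanSpace ℝ (Fin m)) (EuclideanSpace ℝ (Fin (m + 1)))
    (EuclideanSpace ℝ (Fin (m + 1))) (g := A) rfl
    A.toContinuousLinearEquiv.toContinuousLinearMap.mdifferentiableAt
    (contMDiff_sphere_val.mdiffAt x)
  have h3 := h1.symm.trans h2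
  ext u
  have h4 := congrArg (fun T : _ →L[ℝ] EuclideanSpace ℝ (Fin (m + 1)) => T u) h3
  have h5 : mD _ _ A (x : EuclideanSpace ℝ (Fin (m + 1))) =
      A.toContinuousLinearEquiv.toContinuousLinearMap :=
    A.toContinuousLinearEquiv.toContinuousLinearMap.hasFDerivAt.mD_eq
  rw [h5] at h4
  rw [sphereCovector_apply]
  refine (congrArg (inner ℝ v) h4).trans ?_
  rw [← A.inner_map_map (A.symm v), A.apply_symm_apply]
  rfl

/-- A rotation which fixes `x` and `w` and reverses a vector `v` orthogonal to both. -/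
theorem exists_rotation (hm : 3 ≤ m) (x v w : EuclideanSpace ℝ (Fin (m + 1))) (hv : v ≠ 0)
    (hxv : inner ℝ v x = 0) (hvw : inner ℝ v w = 0) :
    ∃ A : EuclideanSpace ℝ (Fin (m + 1)) ≃ₗᵢ[ℝ] EuclideanSpace ℝ (Fin (m + 1)),
      LinearMap.det A.toLinearEquiv.toLinearMap = 1 ∧ A x = x ∧ A v = -v ∧ A w = w := by
  -- Reversing `v` alone would have determinant `-1`; a second direction `k` orthogonal to `x`, `v`,
  -- `w` corrects this. It exists because `m + 1 ≥ 4`.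
  obtain ⟨k, hk, hk0⟩ : ∃ k ∈ (Submodule.span ℝ (Set.range ![x, v, w]))ᗮ, k ≠ 0 := by
    refine Submodule.exists_mem_ne_zero_of_ne_bot fun h => ?_
    have h1 := (Submodule.span ℝ (Set.range ![x, v, w])).finrank_add_finrank_orthogonal
    have h2 := finrank_range_le_card (R := ℝ) ![x, v, w]
    rw [h, finrank_bot, finrank_euclideanSpace_fin, add_zero] at h1
    rw [Set.finrank, h1, Fintype.card_fin] at h2
    omega
  have hk' : ∀ i, inner ℝ k (![x, v, w] i) = 0 := fun i =>
    (Submodule.mem_orthogonal' _ _).1 hk _ (Submodule.subset_span ⟨i, rfl⟩)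
  set L := Submodule.span ℝ (Set.range ![v, k]) with hL
  have hmem : ∀ y, inner ℝ v y = 0 → inner ℝ k y = 0 → y ∈ Lᗮ := fun y h1 h2 => by
    rw [hL, Submodule.mem_orthogonal]
    intro u hu
    induction hu using Submodule.span_induction with
    | mem u hu =>
      obtain ⟨i, rfl⟩ := hu
      fin_cases i
      · exact h1
      · exact h2
    | zero => exact inner_zero_left _
    | add a b _ _ ha hb => rw [inner_add_left, ha, hb, add_zero]
    | smul c a _ ha => rw [inner_smul_left, ha, mul_zero]
  have hfin : Module.finrank ℝ L = 2 := by
    rw [hL, finrank_span_eq_card, Fintype.card_fin]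
    refine linearIndependent_of_ne_zero_of_inner_eq_zero (𝕜 := ℝ) (fun i => ?_) fun i j hij => ?_
    · fin_cases i
      · exact hv
      · exact hk0
    · fin_cases i <;> fin_cases j
      · exact absurd rfl hij
      · exact (real_inner_comm _ _).trans (hk' 1)
      · exact hk' 1
      · exact absurd rfl hij
  refine ⟨Lᗮ.reflection, ?_, Submodule.reflection_mem_subspace_eq_self (hmem x hxv (hk' 0)),
    Submodule.reflection_mem_subspace_orthogonal_precomplement_eq_neg
      (Submodule.subset_span ⟨0, rfl⟩),
    Submodule.reflection_mem_subspace_eq_self (hmem w hvw (hk' 2))⟩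
  refine Lᗮ.det_reflection.trans ?_
  rw [Submodule.orthogonal_orthogonal, hfin]
  norm_num

/-- On the sphere `S^m`, `m ≠ 2`, a bivector field invariant under rotations is trivial. -/
theorem isTrivial_of_invariantUnder_sphereMap (hm : m ≠ 2)
    {π : BivectorField (EuclideanSpace ℝ (Fin m))
      (Metric.sphere (0 : EuclideanSpace ℝ (Fin (m + 1))) 1)}
    (hπ : ∀ A : EuclideanSpace ℝ (Fin (m + 1)) ≃ₗᵢ[ℝ] EuclideanSpace ℝ (Fin (m + 1)),
      LinearMap.det A.toLinearEquiv.toLinearMap = 1 → π.InvariantUnder (sphereMap A)) :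
    π.IsTrivial := by
  intro x
  change π.form x = 0
  rcases Nat.lt_or_ge m 3 with hm' | hm'
  -- Here `m ≤ 1`, and an alternating form on a space of dimension at most `1` is zero.
  · have hfin : Module.finrank ℝ (EuclideanSpace ℝ (Fin m) →L[ℝ] ℝ) ≤ 1 := by
      rw [← (LinearMap.toContinuousLinearMap :
        (EuclideanSpace ℝ (Fin m) →ₗ[ℝ] ℝ) ≃ₗ[ℝ] _).finrank_eq, Subspace.dual_finrank_eq,
        finrank_euclideanSpace_fin]
      omega
    obtain ⟨γ, hγ⟩ := finrank_le_one_iff.1 hfin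
    ext α β
    obtain ⟨a, rfl⟩ := hγ α
    obtain ⟨b, rfl⟩ := hγ β
    rw [map_smul, map_smul, LinearMap.smul_apply, π.form_self]
    simp
  set b : ∀ _ : Metric.sphere (0 : EuclideanSpace ℝ (Fin (m + 1))) 1,
      EuclideanSpace ℝ (Fin (m + 1)) → EuclideanSpace ℝ (Fin (m + 1)) → ℝ :=
    fun y v w => π.form y (sphereCovector y v) (sphereCovector y w) with hb
  have hinv : ∀ A : EuclideanSpace ℝ (Fin (m + 1)) ≃ₗᵢ[ℝ] EuclideanSpace ℝ (Fin (m + 1)),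
      LinearMap.det A.toLinearEquiv.toLinearMap = 1 → A x = x → ∀ v w,
      b x v w = b x (A v) (A w) := fun A hA hAx v w => by
    have h := (π.invariantUnder_iff _).1 (hπ A hA) x
      (sphereCovector (sphereMap A x) (A v)) (sphereCovector (sphereMap A x) (A w))
    rw [sphereCovector_comp, sphereCovector_comp, A.symm_apply_apply, A.symm_apply_apply] at h
    have hx : sphereMap A x = x := Subtype.ext hAx
    change b x v w = b (sphereMap A x) (A v) (A w) at h
    rwa [hx] at h
  have horth : ∀ v w, inner ℝ v (x : EuclideanSpace ℝ (Fin (m + 1))) = 0 → inner ℝ v w = 0 →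
      b x v w = 0 := fun v w hv hw => by
    rcases eq_or_ne v 0 with rfl | hv0
    · simp [hb]
    obtain ⟨A, hA, hAx, hAv, hAw⟩ := exists_rotation hm' x v w hv0 hv hw
    have h := hinv A hA hAx v w
    rw [hAv, hAw] at h
    simp only [hb, map_neg, LinearMap.neg_apply] at h ⊢
    linarith
  ext α β
  obtain ⟨v, rfl⟩ := sphereCovector_surjective x α
  obtain ⟨w, rfl⟩ := sphereCovector_surjective x β
  have hx1 : inner ℝ (x : EuclideanSpace ℝ (Fin (m + 1))) (x : EuclideanSpace ℝ (Fin (m + 1)))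
      = (1 : ℝ) := by
    rw [real_inner_self_eq_norm_sq, norm_eq_of_mem_sphere x, one_pow]
  -- Removing the `x`-component of `v` does not change its covector, and removing the `v'`-component
  -- of `w` changes the value by a multiple of `b x v' v' = 0`. Then `horth` applies.
  set v' := v - (inner ℝ v (x : EuclideanSpace ℝ (Fin (m + 1))) : ℝ) •
    (x : EuclideanSpace ℝ (Fin (m + 1))) with hv'
  have hvx : inner ℝ v' (x : EuclideanSpace ℝ (Fin (m + 1))) = 0 := by
    rw [hv', inner_sub_left, inner_smul_left, hx1]
    simp
  have hcv : sphereCovector x v' = sphereCovector x v := by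
    rw [hv', map_sub, map_smul, sphereCovector_self, smul_zero, sub_zero]
  rw [← hcv]
  rcases eq_or_ne v' 0 with h0 | h0
  · rw [h0, map_zero, map_zero]
    rfl
  have h := horth v' (w - (inner ℝ v' w / inner ℝ v' v' : ℝ) • v') hvx (by
    have : (inner ℝ v' v' : ℝ) ≠ 0 := inner_self_ne_zero.2 h0
    rw [inner_sub_right, inner_smul_right, div_mul_cancel₀ _ this, sub_self])
  simp only [hb, map_sub, map_smul, π.form_self, smul_zero, sub_zero] at h
  exact h

end Sphere

end InvariantPoisson
end

/-! ### Assembly of the correspondences -/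

theorem mainTheorem4
    {E : Type*} [NormedAddCommGroup E] [NormedSpace ℝ E] [FiniteDimensional ℝ E] [CompleteSpace E]
    {G : Type*} [TopologicalSpace G] [T2Space G] [ConnectedSpace G] [ChartedSpace E G] [Group G]
    [LieGroup 𝓘(ℝ, E) ∞ G]
    (H : Subgroup G) (hH : IsClosed (H : Set G))
    {F : Type*} [NormedAddCommGroup F] [NormedSpace ℝ F] [FiniteDimensional ℝ F]
    [ChartedSpace F (G ⧸ H)] [IsHomogeneousManifold E H F] :
    -- reductive pairs
    (∀ (𝔪 : Submodule ℝ (GroupLieAlgebra 𝓘(ℝ, E) G)) (h𝔪 : IsCompl 𝔪 (subgroupLieAlgebra H)),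
      IsAdInvariant H 𝔪 →
      (∃ e : {π : BivectorField F (G ⧸ H) // IsGInvariant π ∧ π.IsPoisson} ≃
            {P : SymplecticSubspace H 𝔪 // P.IsCocyclePair h𝔪},
          ∀ π, IsPairOf π.1 (e π).1) ∧
      -- symmetric pairs
      ((∀ x ∈ 𝔪, ∀ y ∈ 𝔪, ⁅x, y⁆ ∈ subgroupLieAlgebra H) →
        (∀ P : SymplecticSubspace H 𝔪, P.IsCocyclePair h𝔪) ∧
        ∃ e : {π : BivectorField F (G ⧸ H) // IsGInvariant π ∧ π.IsPoisson} ≃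
            SymplecticSubspace H 𝔪,
          ∀ π, IsPairOf π.1 (e π)) ∧
      -- irreducible isotropy representation
      (IsAdIrreducible H 𝔪 →
        ∀ π : BivectorField F (G ⧸ H), IsGInvariant π → π.IsPoisson →
          π.IsTrivial ∨ π.Nondegenerate)) ∧
    -- invariant Poisson structures on odd-dimensional spheres
    (∀ (n : ℕ) (π : BivectorField (EuclideanSpace ℝ (Fin (2 * n + 1)))
        (Metric.sphere (0 : EuclideanSpace ℝ (Fin (2 * n + 2))) 1)),
      (∀ A : EuclideanSpace ℝ (Fin (2 * n + 2)) ≃ₗᵢ[ℝ] EuclideanSpace ℝ (Fin (2 * n + 2)),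
        LinearMap.det A.toLinearEquiv.toLinearMap = 1 → π.InvariantUnder (sphereMap A)) →
      π.IsPoisson → π.IsTrivial) ∧
    -- bi-invariant Poisson structures on Lie groups
    (∃ e : {π : BivectorField E G // IsBiInvariant π ∧ π.IsPoisson} ≃ SymplecticAbelianIdeal E G,
      ∀ π, IsIdealOf π.1 (e π)) := by
  refine ⟨fun 𝔪 h𝔪 hAd => ?_, fun n π hπ _ =>
    -- An odd dimension avoids `m = 2`, where the area form of `S^2` gives a nontrivial invariant
    -- bivector field.
    isTrivial_of_invariantUnder_sphereMap (m := 2 * n + 1) (by omega) hπ, ?_⟩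
  · have key : ∃ e : {π : BivectorField F (G ⧸ H) // IsGInvariant π ∧ π.IsPoisson} ≃
        {P : SymplecticSubspace H 𝔪 // P.IsCocyclePair h𝔪}, ∀ π, IsPairOf π.1 (e π).1 := by
      refine exists_equiv_of_relation
        (A := {π : BivectorField F (G ⧸ H) // IsGInvariant π ∧ π.IsPoisson})
        (B := {P : SymplecticSubspace H 𝔪 // P.IsCocyclePair h𝔪})
        (fun π P => IsPairOf π.1 P.1) (fun π => ?_)
        (fun π P P' h h' => Subtype.ext (h.eq_of_right h')) (fun P => ?_)
        (fun π π' P h h' => Subtype.ext (h.eq_of_left h𝔪 π.2.1 π'.2.1 h'))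
      · obtain ⟨P, hP⟩ := exists_isPairOf h𝔪 hAd π.2.1
        exact ⟨⟨P, (hP.isPoisson_iff hH h𝔪 π.2.1).1 π.2.2⟩, hP⟩
      · obtain ⟨π, hπ, hP⟩ := exists_isGInvariant_isPairOf (F := F) h𝔪 P.1
        exact ⟨⟨π, hπ, (hP.isPoisson_iff hH h𝔪 hπ).2 P.2⟩, hP⟩
    refine ⟨key, fun hsymm => ?_, fun hirr π hπ _ => isTrivial_or_nondegenerate h𝔪 hAd hirr hπ⟩
    have hall := fun P : SymplecticSubspace H 𝔪 => P.isCocyclePair_of_symmetric h𝔪 hsymm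
    obtain ⟨e, he⟩ := key
    exact ⟨hall, e.trans (Equiv.subtypeUnivEquiv hall), he⟩
  · refine exists_equiv_of_relation
      (A := {π : BivectorField E G // IsBiInvariant π ∧ π.IsPoisson})
      (B := SymplecticAbelianIdeal E G) (fun π P => IsIdealOf π.1 P)
      (fun π => exists_isIdealOf π.2.1 π.2.2) (fun π P P' h h' => h.eq_of_right h') (fun P => ?_)
      (fun π π' P h h' => Subtype.ext (h.eq_of_left π.2.1 π'.2.1 h'))
    obtain ⟨π, hπ, hP, h⟩ := exists_isBiInvariant_isIdealOf P
    exact ⟨⟨π, hπ, hP⟩, h⟩
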